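/- **Setting.** For $i=1,2$ let $A_i,B_i\in\mathbb C[y]$, $B_i\neq0$, $d_i=\deg A_i$, $q_i=\deg B_i$, $d_i\ge q_i+1$, be reduced: the common zeros of $A_i$ and $B_i$ are simple zeros of $B_i$. Put $V_i'=(A_i+B_i')/B_i$, $\widehat V_2'=A_2/B_2$ (so $e^{\widehat V_2}=e^{V_2}/B_2$), and let $e^{-V_1},e^{-V_2},e^{\widehat V_2}$ be zero-free holomorphic branches on connected open sets $\mathcal D_1,\mathcal D_2,\widehat{\mathcal D}_2$. A $C^1$ curve in $\mathcal D_i$ is *admissible* for $e^{-V_i}$ if it is a closed curve of finite length, or if each of its two ends is of one of these types: (1) it tends to $\infty$ inside a closed subsector of a sector in which the leading term of $V_i$ at $\infty$ has positive real part; (2) it tends to a zero $b$ of $B_i$ of multiplicity $\ge2$ inside a closed subsector of a sector at $b$ in which the leading term of $V_i$ at $b$ has positive real part; (3) it tends with finite length to a simple zero of $B_i$ at which the residue of $V_i'$ is $-k$ with $k\in\{0,1,2,\dots\}$ ($k=0$: hard edge). In (1) and (2) the speed $|\gamma'|$ is eventually at most a constant times the rate at which $|\gamma|$ increases, respectively $|\gamma-b|$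 decreases. Admissibility for $e^{\widehat V_2}$ is the same with $V_2$ replaced by $-\widehat V_2$. Let $\Gamma_{x,\mu}$ ($1\le\mu\le d_1$), $\Gamma_{y,\nu}$, $\widehat\Gamma_\nu$ ($1\le\nu\le d_2$) be admissible contours for $e^{-V_1},e^{-V_2},e^{\widehat V_2}$, let $\varkappa_{\mu,\nu}\in\mathbb C$, and put $$\iint_\varkappa=\sum_{\mu,\nu}\varkappa_{\mu,\nu}\int_{\Gamma_{x,\mu}}\int_{\Gamma_{y,\nu}},\qquad \mathcal L(p|s)=\iint_\varkappa p(x)s(y)e^{-V_1(x)-V_2(y)+xy}\,dx\,dy .$$ If $d_1=q_1+1$ and $d_2=q_2+1$, assume in addition that the moment integrals of $x^iy^j$ over $\Gamma_{x,\mu}\times\Gamma_{y,\nu}$ converge absolutely whenever $\varkappa_{\mu,\nu}\ne0$. Let $p_n=\pi_n/\sqrt{h_n}$, $s_n=\sigma_n/\sqrt{h_n}$ ($n\ge0$), where $\pi_n,\sigma_n$ are monic of degree $n$ and $\mathcal L(\pi_n|\sigma_m)=h_n\delta_{nm}$, $h_n\ne0$; assume that they exist. Assume also that all the minors $\det[\mathcal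 L(x^i|B_2y^j)]_{0\le i,j\le n-1}$, $n\geq 0$, are nonzero. **Definitions.** $\widehat L,\widehat A$ are semi-infinite matrices such that $\widehat L$ is strictly lower triangular with $q_2$ subdiagonals, $\widehat A$ is lower Hessenberg with $d_2$ subdiagonals, and, with $\mathbf s=[s_0,s_1,\dots]^t$, the entries of $(\mathbf 1+\widehat L^t)\mathbf s$ are divisible by $B_2$ and $$(\partial_y-V_2')(\mathbf 1+\widehat L^t)\mathbf s=-\widehat A^t\mathbf s .$$ Put $\psi_n=p_ne^{-V_1}$, $\phi_n=s_ne^{-V_2}$, $\Psi=[\psi_0,\psi_1,\dots]^t$, $\Phi=[\phi_0,\phi_1,\dots]^t$, $\widehat\Psi=(\mathbf 1+\widehat L)^{-1}\Psi$, $\widehat\Phi=(\mathbf 1+\widehat L^t)\Phi$, $$\mathcal B_2(x;y,s)=\frac{B_2(y)-B_2(s)}{y-s}\Big(x-\frac1{y-s}\Big)-\frac{A_2(y)-B_2'(s)-A_2(s)}{y-s}$$ (a polynomial), $\Psi^{(0)}=\Psi$ and, for $1\le j,k\le d_2$, $$\Psi^{(k)}(x)=\frac1{2\pi i}\int_{\widehat\Gamma_k}ds\iint_\varkappa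 d\xi\,dy\,\mathcal B_2(x;y,s)\,e^{\xi y-xs-V_2(y)+\widehat V_2(s)}\,\frac{\Psi(\xi)}{x-\xi},$$ $$\underline\Phi^{(0)}(z)=e^{V_1(z)}\iint_\varkappa\frac{e^{\xi y-V_1(\xi)}}{z-\xi}\Phi(y)\,d\xi\,dy,\qquad \underline\Phi^{(j)}(z)=\int_{\Gamma_{y,j}}e^{zy}\Phi(y)\,dy .$$ $\widehat\Psi^{(k)}$ and $\widehat{\underline\Phi}{}^{(j)}$ are defined by the same formulas with $\Psi,\Phi$ replaced by $\widehat\Psi,\widehat\Phi$ (everything else unchanged). $\Pi_n$ is the projector on the first $n$ entries. With entries of negative index set to $0$, put $\underline\Phi^{(j)}_n=[\underline\phi^{(j)}_{n-1},\dots,\underline\phi^{(j)}_{n+d_2-1}]$, $\widehat\Psi^{(k)}_n=[\widehat\psi^{(k)}_{n-d_2},\dots,\widehat\psi^{(k)}_n]^t$, and let $\widehat{\mathbb A}(x)$ be the block of $[\widehat A-x\widehat L,\Pi_n]$ with rows $n-1,\dots,n+d_2-1$ and columns $n-d_2,\dots,n$. **Theorem (auxiliary Christoffel–Darboux identities).**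 The matrices $\widehat L,\widehat A$ exist and are unique, and the following hold. **(a)** For all $n\ge1$, all $x,z\in\mathcal D_1$ with $z$ not in the closure of any $\Gamma_{x,\mu}$: $$(z-x)\,\underline\Phi^{(0)}(z)^t\,\Pi_n\Psi^{(0)}(x)=\underline\Phi^{(0)}_n(z)\,\widehat{\mathbb A}(z)\,\widehat\Psi^{(0)}_n(x)+e^{V_1(z)-V_1(x)},$$ $$(z-x)\,\widehat{\underline\Phi}{}^{(0)}(z)^t\,\Pi_n\widehat\Psi^{(0)}(x)=\underline\Phi^{(0)}_n(z)\,\widehat{\mathbb A}(x)\,\widehat\Psi^{(0)}_n(x)+e^{V_1(z)-V_1(x)}.$$ **(b)** For all $n\ge d_2$, $1\le j,k\le d_2$, and all $x,z\in\mathbb C$ with $x$ not in the closure of any $\Gamma_{x,\mu}$: $$(z-x)\,\underline\Phi^{(j)}(z)^t\,\Pi_n\Psi^{(k)}(x)=\underline\Phi^{(j)}_n(z)\,\widehat{\mathbb A}(z)\,\widehat\Psi^{(k)}_n(x)-I_{jk}(z,x),$$ $$(z-x)\,\widehat{\underline\Phi}{}^{(j)}(z)^t\,\Pi_n\widehat\Psi^{(k)}(x)=\underline\Phi^{(j)}_n(z)\,\widehat{\mathbb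 A}(x)\,\widehat\Psi^{(k)}_n(x)-I_{jk}(z,x),$$ $$I_{jk}(z,x)=\frac1{2\pi i}\int_{\Gamma_{y,j}}dy\int_{\widehat\Gamma_k}ds\;\mathcal B_2(x;y,s)\,e^{yz-xs+\widehat V_2(s)-V_2(y)} .$$ -/

import Mathlib

open Polynomial Filter Topology MeasureTheory

noncomputable section

namespace CDI

/-! ## Weights and admissible contours for a pair of polynomials `A`, `B`

The potential `V` of the pair `(A, B)` is given by `dV/dy = (A + dB/dy) / B`. -/

/-- `A` and `B` are reduced: their common zeros are simple zeros of `B`. -/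
def Reduced (A B : ℂ[X]) : Prop :=
  ∀ c : ℂ, A.IsRoot c → B.IsRoot c → B.rootMultiplicity c = 1

/-- `W` is a (holomorphic, zero-free) branch of `exp (-V)` on the domain `D`, where
`dV/dy = (A + dB/dy) / B`. The domain may contain zeros of `B` at which `W` is regular and
nonzero (hard edges), and it need not be simply connected (poles of `W` need no cut). -/
structure IsWeight (A B : ℂ[X]) (D : Set ℂ) (W : ℂ → ℂ) : Prop where
  isOpen : IsOpen D
  isConnected : IsConnected D
  ne_zero : ∀ y ∈ D, W y ≠ 0
  differentiableAt : ∀ y ∈ D, DifferentiableAt ℂ W y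
  ode : ∀ y ∈ D, B.eval y * deriv W y = -((A + derivative B).eval y) * W y

/-- The polynomial which, paired with `B`, has `exp Vhat` as its weight, where
`dVhat/ds = A / B`, that is `exp Vhat = exp V / B`. -/
def dualPoly (A B : ℂ[X]) : ℂ[X] := -(A + derivative B)

/-- As `t → +∞` the curve `γ` goes to infinity inside a closed subsector of a sector in which
the leading term `v y ^ (d + 1) / (d + 1)` of `V` at infinity has positive real part
(`d = deg A - deg B` and `v` is the quotient of the leading coefficients), its arc length being
controlled by the distance to the origin. -/
def EndAtInfinity (A B : ℂ[X]) (γ : ℝ → ℂ) : Prop :=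
  Tendsto (fun t => ‖γ t‖) atTop atTop ∧
  (∃ c > 0, ∀ᶠ t in atTop,
    c * ‖γ t‖ ^ (A.natDegree - B.natDegree + 1) ≤
      ((A.leadingCoeff / B.leadingCoeff) * γ t ^ (A.natDegree - B.natDegree + 1)).re) ∧
  ∃ K > 0, ∀ᶠ t in atTop, ‖deriv γ t‖ ≤ K * deriv (fun τ => ‖γ τ‖) t

/-- As `t → +∞` the curve `γ` goes to a multiple zero `b` of `B`, of multiplicity `m + 1`,
inside a closed subsector of a sector in which the leading term `T / (m (y - b) ^ m)` of `V`
at `b` has positive real part, its arc length being controlled by the distance to `b`.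
Here `B = (y - b) ^ (m + 1) * Q` and `T = -(A + dB/dy)(b) / Q(b)`. -/
def EndAtSingularity (A B : ℂ[X]) (b : ℂ) (γ : ℝ → ℂ) : Prop :=
  2 ≤ B.rootMultiplicity b ∧
  Tendsto γ atTop (𝓝 b) ∧
  (∃ c > 0, ∀ᶠ t in atTop,
    c * (‖γ t - b‖ ^ (B.rootMultiplicity b - 1))⁻¹ ≤
      (-((A + derivative B).eval b / (B /ₘ (X - C b) ^ B.rootMultiplicity b).eval b) *
        ((γ t - b) ^ (B.rootMultiplicity b - 1))⁻¹).re) ∧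
  ∃ K > 0, ∀ᶠ t in atTop, ‖deriv γ t‖ ≤ -(K * deriv (fun τ => ‖γ τ - b‖) t)

/-- As `t → +∞` the curve `γ` goes, with finite length, to a simple zero `b` of `B` at which
`exp (-V)` is regular, that is, it behaves as `(y - b) ^ k` with `k` a natural number:
the residue of `dV/dy` at `b` is `-k`. Hard edges are the case `k = 0`. -/
def EndAtRegular (A B : ℂ[X]) (b : ℂ) (γ : ℝ → ℂ) : Prop :=
  B.rootMultiplicity b = 1 ∧
  (∃ k : ℕ, (A + derivative B).eval b = -(k : ℂ) * (derivative B).eval b) ∧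
  Tendsto γ atTop (𝓝 b) ∧
  IntegrableOn (deriv γ) (Set.Ici 0)

/-- The behaviours allowed at the end `t → +∞` of a contour. -/
def AdmissibleEnd (A B : ℂ[X]) (γ : ℝ → ℂ) : Prop :=
  EndAtInfinity A B γ ∨ (∃ b, EndAtSingularity A B b γ) ∨ (∃ b, EndAtRegular A B b γ)

/-- The curve leaves a point of `D` as `t` starts from `-∞` and returns to it as `t → +∞`,
with finite length. -/
def ClosedIn (D : Set ℂ) (γ : ℝ → ℂ) : Prop :=
  (∃ p ∈ D, Tendsto γ atBot (𝓝 p) ∧ Tendsto γ atTop (𝓝 p)) ∧ Integrable (deriv γ)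

/-- Admissible contours in the domain `D` of the weight, as curves parametrized by `ℝ`. The
class contains closed loops (circles around poles of the weight), arcs from infinity to infinity
(lassoes, petals at infinity), arcs from a multiple zero of `B` to itself or to infinity (petals
and stems), and arcs from a regular point or hard edge to infinity or to another end. -/
structure IsAdmissible (A B : ℂ[X]) (D : Set ℂ) (γ : ℝ → ℂ) : Prop where
  contDiff : ContDiff ℝ 1 γ
  mem : ∀ t, γ t ∈ D
  ends : ClosedIn D γ ∨ (AdmissibleEnd A B γ ∧ AdmissibleEnd A B (fun t => γ (-t)))

/-- The contour integral of `f` along `γ`. -/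
def lineInt (γ : ℝ → ℂ) (f : ℂ → ℂ) : ℂ := ∫ t : ℝ, f (γ t) * deriv γ t

/-! ## Semiclassical bimoment functionals -/

/-- The data of a reduced semiclassical bimoment functional of type BB in integral form, together
with the contours for the dual weight in the second variable. -/
structure Data where
  /-- the polynomials of the first variable -/
  A₁ : ℂ[X]
  B₁ : ℂ[X]
  /-- the polynomials of the second variable -/
  A₂ : ℂ[X]
  B₂ : ℂ[X]
  B₁_ne_zero : B₁ ≠ 0
  B₂_ne_zero : B₂ ≠ 0
  deg₁ : B₁.natDegree + 1 ≤ A₁.natDegree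
  deg₂ : B₂.natDegree + 1 ≤ A₂.natDegree
  reduced₁ : Reduced A₁ B₁
  reduced₂ : Reduced A₂ B₂
  /-- `W₁ = exp (-V₁)` on `D₁` -/
  D₁ : Set ℂ
  W₁ : ℂ → ℂ
  isWeight₁ : IsWeight A₁ B₁ D₁ W₁
  /-- `W₂ = exp (-V₂)` on `D₂` -/
  D₂ : Set ℂ
  W₂ : ℂ → ℂ
  isWeight₂ : IsWeight A₂ B₂ D₂ W₂
  /-- `Wd = exp Vhat₂ = exp V₂ / B₂` on `Dd` -/
  Dd : Set ℂ
  Wd : ℂ → ℂ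
  isWeightd : IsWeight (dualPoly A₂ B₂) B₂ Dd Wd
  /-- the contours in the first variable -/
  Γx : Fin A₁.natDegree → ℝ → ℂ
  admissible_x : ∀ μ, IsAdmissible A₁ B₁ D₁ (Γx μ)
  /-- the contours in the second variable -/
  Γy : Fin A₂.natDegree → ℝ → ℂ
  admissible_y : ∀ ν, IsAdmissible A₂ B₂ D₂ (Γy ν)
  /-- the dual contours in the second variable -/
  Γd : Fin A₂.natDegree → ℝ → ℂ
  admissible_d : ∀ k, IsAdmissible (dualPoly A₂ B₂) B₂ Dd (Γd k)
  /-- the coefficients of the functional -/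
  κ : Fin A₁.natDegree → Fin A₂.natDegree → ℂ
  /-- When both potentials grow only quadratically at infinity, the decay of the weights alone
  does not dominate `exp (x y)`: the moments are then required to converge absolutely. -/
  converges : A₁.natDegree = B₁.natDegree + 1 → A₂.natDegree = B₂.natDegree + 1 →
    ∀ μ ν, κ μ ν ≠ 0 → ∀ i j : ℕ, Integrable (fun q : ℝ × ℝ =>
      Γx μ q.1 ^ i * Γy ν q.2 ^ j * W₁ (Γx μ q.1) * W₂ (Γy ν q.2) *
        Complex.exp (Γx μ q.1 * Γy ν q.2) * (deriv (Γx μ) q.1 * deriv (Γy ν) q.2))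

/-- `d₂ = deg A₂` -/
def Data.d (S : Data) : ℕ := S.A₂.natDegree

/-- `q₂ = deg B₂` -/
def Data.q (S : Data) : ℕ := S.B₂.natDegree

/-- The double integral `∬_κ F(ξ, y) dξ dy`. -/
def Data.dbl (S : Data) (F : ℂ → ℂ → ℂ) : ℂ :=
  ∑ μ, ∑ ν, S.κ μ ν * lineInt (S.Γx μ) (fun ξ => lineInt (S.Γy ν) (fun y => F ξ y))

/-- The bimoment functional `ℒ(p | s)`. -/
def Data.ℒ (S : Data) (p s : ℂ[X]) : ℂ :=
  S.dbl fun x y => p.eval x * s.eval y * (S.W₁ x * S.W₂ y * Complex.exp (x * y))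

/-- The associated functional `ℒ(p | B₂ s)`. -/
def Data.ℒhat (S : Data) (p s : ℂ[X]) : ℂ := S.ℒ p (S.B₂ * s)

/-- The principal minor `Δ_n` of the matrix of bimoments of a functional. -/
def minor (F : ℂ[X] → ℂ[X] → ℂ) (n : ℕ) : ℂ :=
  (Matrix.of fun i j : Fin n => F (X ^ (i : ℕ)) (X ^ (j : ℕ))).det

/-- `p n = π n / √(h n)` and `s n = σ n / √(h n)` are the normalized biorthogonal polynomials of
the functional `F`, for some choice `r n` of the square roots of `h n`. -/
def IsNormalizedBOP (F : ℂ[X] → ℂ[X] → ℂ) (p s : ℕ → ℂ[X]) : Prop :=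
  ∃ (π σ : ℕ → ℂ[X]) (r : ℕ → ℂ),
    (∀ n, (π n).Monic ∧ (π n).natDegree = n) ∧
    (∀ n, (σ n).Monic ∧ (σ n).natDegree = n) ∧
    (∀ n, r n ≠ 0) ∧
    (∀ n m, F (π n) (σ m) = if n = m then r n ^ 2 else 0) ∧
    (∀ n, p n = C (r n)⁻¹ * π n) ∧
    (∀ n, s n = C (r n)⁻¹ * σ n)

/-! ## Recurrence matrices and associated polynomials -/

/-- The entry `n` of the vector `(1 + Lhatᵗ) f`, for `Lhat` strictly lower triangular with `q₂`
subdiagonals. -/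
def Data.upperCombo (S : Data) {E : Type*} [AddCommMonoid E] [Module ℂ E]
    (Lh : ℕ → ℕ → ℂ) (f : ℕ → E) (n : ℕ) : E :=
  f n + ∑ j ∈ Finset.Icc 1 S.q, Lh (n + j) n • f (n + j)

/-- The defining properties of the matrices `Lhat`, `Ahat`: `Lhat` is strictly lower triangular with
`q₂` subdiagonals, `Ahat` is lower Hessenberg with `d₂` subdiagonals, the entries of
`(1 + Lhatᵗ) s` are divisible by `B₂`, and
`(d/dy - (A₂ + dB₂/dy) / B₂) (1 + Lhatᵗ) s = -Ahatᵗ s` (stated after multiplication by `B₂`). -/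
structure Data.IsDiffRec (S : Data) (s : ℕ → ℂ[X]) (Lh Ah : ℕ → ℕ → ℂ) : Prop where
  band_L : ∀ i n, Lh i n ≠ 0 → n < i ∧ i ≤ n + S.q
  band_A : ∀ i n, Ah i n ≠ 0 → n ≤ i + 1 ∧ i ≤ n + S.d
  dvd : ∀ n, S.B₂ ∣ S.upperCombo Lh s n
  diff_eq : ∀ n, S.B₂ * derivative (S.upperCombo Lh s n)
      - (S.A₂ + derivative S.B₂) * S.upperCombo Lh s n
    = -(S.B₂ * ∑ i ∈ Finset.range (n + S.d + 1), Ah i n • s i)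

/-- The vector `phat = (1 + Lhat)⁻¹ p`, that is, the solution of `(1 + Lhat) phat = p`
by forward substitution. -/
def hatPoly (Lh : ℕ → ℕ → ℂ) (p : ℕ → ℂ[X]) : ℕ → ℂ[X]
  | n => p n - ∑ m : Fin n, Lh n m • hatPoly Lh p m
termination_by n => n
decreasing_by exact m.2

/-! ## Wave vectors -/

/-- The quasipolynomials `p n * exp (-V₁)`. -/
def Data.ψ (S : Data) (p : ℕ → ℂ[X]) (n : ℕ) : ℂ → ℂ := fun x => (p n).eval x * S.W₁ x

/-- The quasipolynomials `s n * exp (-V₂)`. -/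
def Data.φ (S : Data) (s : ℕ → ℂ[X]) (n : ℕ) : ℂ → ℂ := fun y => (s n).eval y * S.W₂ y

/-- The entries of the vector `(1 + Lhatᵗ) Φ`. -/
def Data.φhat (S : Data) (s : ℕ → ℂ[X]) (Lh : ℕ → ℕ → ℂ) (n : ℕ) : ℂ → ℂ :=
  S.upperCombo Lh (S.φ s) n

/-- The quasipolynomials `phat n * exp (-V₁)`. -/
def Data.ψhat (S : Data) (p : ℕ → ℂ[X]) (Lh : ℕ → ℕ → ℂ) (n : ℕ) : ℂ → ℂ :=
  S.ψ (hatPoly Lh p) n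

/-- The kernel of the bilinear concomitant, a polynomial in `x`, `y`, `s`; its value on the diagonal
`y = s` is the limit of the quotient. -/
def concomitant (A B : ℂ[X]) (x y s : ℂ) : ℂ :=
  if y = s then
    x * (derivative B).eval s - (derivative (derivative B)).eval s / 2 - (derivative A).eval s
  else
    (B.eval y - B.eval s) / (y - s) * (x - 1 / (y - s))
      - (A.eval y - (derivative B).eval s - A.eval s) / (y - s)

/-- The transform defining the auxiliary wave vectors, applied to the function `g` of the first
variable. -/
def Data.aux (S : Data) (k : Fin S.d) (g : ℂ → ℂ) (x : ℂ) : ℂ :=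
  1 / (2 * Real.pi * Complex.I) * lineInt (S.Γd k) fun s => S.dbl fun ξ y =>
    concomitant S.A₂ S.B₂ x y s * (Complex.exp (ξ * y - x * s) * S.W₂ y * S.Wd s) *
      (1 / (x - ξ)) * g ξ

/-- The transform defining the dual wave vector with upper index `0`, applied to the function `f` of
the second variable. -/
def Data.dualZero (S : Data) (f : ℂ → ℂ) (z : ℂ) : ℂ :=
  (S.W₁ z)⁻¹ * S.dbl fun ξ y => Complex.exp (ξ * y) * S.W₁ ξ * (1 / (z - ξ)) * f y

/-- The Fourier-Laplace transform along the contour `Γy j`, defining the other dual wave vectors. -/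
def Data.dual (S : Data) (j : Fin S.d) (f : ℂ → ℂ) (z : ℂ) : ℂ :=
  lineInt (S.Γy j) fun y => Complex.exp (z * y) * f y

/-- The double integral of the bilinear concomitant kernel. -/
def Data.concInt (S : Data) (j k : Fin S.d) (z x : ℂ) : ℂ :=
  1 / (2 * Real.pi * Complex.I) * lineInt (S.Γy j) fun y => lineInt (S.Γd k) fun s =>
    concomitant S.A₂ S.B₂ x y s * (Complex.exp (y * z - x * s) * S.Wd s * S.W₂ y)

/-- The point lies neither on the contours `Γx μ` nor at their endpoints. -/
def Data.OffContours (S : Data) (w : ℂ) : Prop := ∀ μ, w ∉ closure (Set.range (S.Γx μ))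

/-! ## The Christoffel-Darboux pairing -/

/-- `uᵗ Π_n v`, where `Π_n` is the projector on the first `n` entries. -/
def truncPair (n : ℕ) (u v : ℕ → ℂ) : ℂ := ∑ r ∈ Finset.range n, u r * v r

/-- The entry `(i, j)` of the commutator `[M, Π_n]`. -/
def commEntry (M : ℕ → ℕ → ℂ) (n i j : ℕ) : ℂ :=
  M i j * (if j < n then 1 else 0) - (if i < n then 1 else 0) * M i j

/-- The block of `[Ahat - x Lhat, Π_n]` with rows `n - 1, …, n + d - 1` and columns `n - d, …, n`
(zero in the columns with negative index), for `n ≥ 1`. -/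
def cdMatrix (d n : ℕ) (Lh Ah : ℕ → ℕ → ℂ) (x : ℂ) : Matrix (Fin (d + 1)) (Fin (d + 1)) ℂ :=
  Matrix.of fun a b =>
    if d ≤ n + b then
      commEntry (fun i j => Ah i j - x * Lh i j) n (n + a - 1) (n + b - d)
    else 0

/-- The window `[u_{n-1}, …, u_{n+d-1}]`, for `n ≥ 1`. -/
def dualWindow (d n : ℕ) (u : ℕ → ℂ) : Fin (d + 1) → ℂ := fun a => u (n + a - 1)

/-- The window `[v_{n-d}, …, v_n]`, the entries with negative index being zero. -/
def window (d n : ℕ) (v : ℕ → ℂ) : Fin (d + 1) → ℂ :=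
  fun b => if d ≤ n + b then v (n + b - d) else 0

/-- The product of the windows of `u` and `v` with the Christoffel-Darboux matrix at `w`. -/
def cdPair (d n : ℕ) (Lh Ah : ℕ → ℕ → ℂ) (w : ℂ) (u v : ℕ → ℂ) : ℂ :=
  dualWindow d n u ⬝ᵥ (cdMatrix d n Lh Ah w).mulVec (window d n v)

end CDI

end

noncomputable section

namespace CDI

/-! ### A Grönwall estimate and exponential decay along a curve -/

/-! Once every wave vector is seen as a linear functional applied to polynomials, the theorem is
linear algebra. Let `T n` be the quotient of entry `n` of `(1 + Lhatᵗ) s` by `B₂`. The matrix `Ahat`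
then has two readings. It expands `B₂ T' - A₂ T` in the `s i` (by definition, up to sign), and it
expands `x p i` in the entries of `phat`. They agree because integration by parts in `y` exchanges
multiplication by `x` with `T ↦ -(B₂ T' - A₂ T)` (`Data.IsDiffRec.bilin_X_mul`,
`Data.IsDiffRec.X_mul_eq_sum`). For functionals `U` on polynomials in `y` and `V` on polynomials in
`x`, the vectors `u = U(s)` and `v = V(phat)` satisfy `z (1 + Lhatᵗ) u = Ahatᵗ u + e` and `x (1 +
Lhat) v = Ahat v + c`. The terms `e` and `c` measure the failure of integration by parts for `U` and
of multiplication by `x` for `V`. Truncating by `Π_n` turns `(z - x) uᵗ Π_n (1 + Lhat) v` into the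
commutator form plus `e` and `c` sums (`christoffelDarboux`).

In (a), `V` is evaluation at `x`, so `c = 0`, while the Cauchy kernel in `U` gives `e m`
proportional to `ℒ(1 | B₂ T m)`. The sum `∑ ℒ(1 | B₂ T m) phat m` is the expansion of `1`. In (b),
`U` is a Laplace transform without boundary terms, so `e = 0`. Integrating out `s` leaves a
polynomial `Q` in `y` of degree below `d₂` (`Data.exists_aux_eq`), and `c r = ℒ(p r | Q)`. As `n ≥
d₂`, the sum `∑ U(s r) ℒ(p r | Q)` is `U(Q)`, which is the concomitant integral.

The matrices come from the unique `T n` of degree at most `n` with `ℒ(p m | B₂ T n) = δ_{mn}` for `m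
≤ n`; the nonzero minors make this linear system solvable.

The analysis supplies absolute convergence and the vanishing or cancellation of boundary terms. Both
follow from bounds on the weight at each kind of end, obtained by a Grönwall argument along the
curve. -/

theorem norm_le_mul_exp_of_norm_deriv_le {u u' : ℝ → ℂ} {H H' : ℝ → ℝ} {t₀ : ℝ}
    (hu : ∀ t, t₀ ≤ t → HasDerivAt u (u' t) t) (hH : ∀ t, t₀ ≤ t → HasDerivAt H (H' t) t)
    (hle : ∀ t, t₀ ≤ t → ‖u' t‖ ≤ H' t * ‖u t‖) {t : ℝ} (ht : t₀ ≤ t) :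
    ‖u t‖ ≤ ‖u t₀‖ * Real.exp (H t - H t₀) := by
  -- The squared norm stays differentiable where `u` vanishes; after multiplication by `exp (-2H)`
  -- it is nonincreasing.
  have hder : ∀ t, t₀ ≤ t → HasDerivAt (fun t => ‖u t‖ ^ 2 * Real.exp (-(2 * H t)))
      (2 * inner ℝ (u t) (u' t) * Real.exp (-(2 * H t))
        + ‖u t‖ ^ 2 * (Real.exp (-(2 * H t)) * -(2 * H' t))) t := fun t ht =>
    (hu t ht).norm_sq.mul ((hH t ht).const_mul 2).neg.exp
  have hanti : AntitoneOn (fun t => ‖u t‖ ^ 2 * Real.exp (-(2 * H t))) (Set.Ici t₀) := by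
    apply antitoneOn_of_deriv_nonpos (convex_Ici _)
    · exact fun t ht => (hder t ht).continuousAt.continuousWithinAt
    · intro t ht
      rw [interior_Ici] at ht
      exact (hder t ht.le).differentiableAt.differentiableWithinAt
    · intro t ht
      rw [interior_Ici] at ht
      rw [(hder t (le_of_lt ht)).deriv]
      have h1 : inner ℝ (u t) (u' t) ≤ H' t * ‖u t‖ ^ 2 := by
        refine (real_inner_le_norm _ _).trans ?_
        have := mul_le_mul_of_nonneg_left (hle t (le_of_lt ht)) (norm_nonneg (u t))
        linarith
      have h2 := Real.exp_pos (-(2 * H t))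
      nlinarith
  have h := hanti (Set.mem_Ici.2 le_rfl) (Set.mem_Ici.2 ht) ht
  have h2 : ‖u t‖ ^ 2 ≤ (‖u t₀‖ * Real.exp (H t - H t₀)) ^ 2 := by
    have e1 : (‖u t₀‖ * Real.exp (H t - H t₀)) ^ 2
        = ‖u t₀‖ ^ 2 * Real.exp (-(2 * H t₀)) * Real.exp (2 * H t) := by
      rw [mul_pow, mul_assoc, ← Real.exp_add, ← Real.exp_nat_mul]
      congr 2
      push_cast
      ring
    have e2 : ‖u t‖ ^ 2 = ‖u t‖ ^ 2 * Real.exp (-(2 * H t)) * Real.exp (2 * H t) := by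
      rw [mul_assoc, ← Real.exp_add]
      simp
    rw [e1, e2]
    exact mul_le_mul_of_nonneg_right h (Real.exp_pos _).le
  exact le_of_sq_le_sq h2 (by positivity)

/-- This serves both singular types of end: `w` is the curve at infinity, and `1 / (γ - b)` at a
multiple zero. Since `dV/dw = g` is close to `a w ^ m`, multiplying `u` by the exponential of the
leading term `a w ^ (m + 1) / (m + 1)` leaves a remainder `U` with small logarithmic derivative. The
speed condition bounds its growth by that of a power of `‖w‖`. -/
theorem exists_exp_decay {w w' u g : ℝ → ℂ} {a : ℂ} {m : ℕ} {c K : ℝ} (hc : 0 < c) (hK : 0 < K)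
    (hw : ∀ᶠ t in atTop, HasDerivAt w (w' t) t)
    (hu : ∀ᶠ t in atTop, HasDerivAt u (-(g t * w' t * u t)) t)
    (hinf : Tendsto (fun t => ‖w t‖) atTop atTop)
    (hg : Tendsto (fun t => g t / w t ^ m) atTop (𝓝 a))
    (hre : ∀ᶠ t in atTop, c * ‖w t‖ ^ (m + 1) ≤ (a * w t ^ (m + 1)).re)
    (hspeed : ∀ᶠ t in atTop, ‖w' t‖ ≤ K * deriv (fun τ => ‖w τ‖) t) :
    ∃ C c' : ℝ, 0 < c' ∧ ∀ᶠ t in atTop, ‖u t‖ ≤ C * Real.exp (-(c' * ‖w t‖ ^ (m + 1))) := by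
  have hm : (0 : ℝ) < m + 1 := by positivity
  have hmC : ((m : ℂ) + 1) ≠ 0 := by exact_mod_cast hm.ne'
  -- With the speed constant `K`, this error lets `U` grow at only half the guaranteed rate of decay
  -- `c` of the leading exponential.
  have hε : 0 < c / (2 * K) := by positivity
  have hclose : ∀ᶠ t in atTop, ‖a * w t ^ m - g t‖ ≤ c / (2 * K) * ‖w t‖ ^ m := by
    filter_upwards [(Metric.tendsto_nhds.1 hg) _ hε, hinf.eventually_gt_atTop 0] with t h1 h2
    have hw0 : w t ^ m ≠ 0 := pow_ne_zero _ (norm_pos_iff.1 h2)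
    have : a * w t ^ m - g t = -(g t / w t ^ m - a) * w t ^ m := by
      field_simp
      ring
    rw [this, norm_mul, norm_neg, norm_pow]
    rw [dist_eq_norm] at h1
    exact mul_le_mul_of_nonneg_right h1.le (by positivity)
  obtain ⟨t₀, ht₀⟩ := eventually_atTop.1
    (((((hw.and hu).and hclose).and hre).and hspeed).and (hinf.eventually_gt_atTop 0))
  set H : ℝ → ℝ := fun t => c / 2 / (m + 1) * ‖w t‖ ^ (m + 1) with hHdef
  set U : ℝ → ℂ := fun t => u t * Complex.exp (a / (m + 1) * w t ^ (m + 1)) with hUdef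
  have hnorm : ∀ t, t₀ ≤ t → HasDerivAt (fun τ => ‖w τ‖) (deriv (fun τ => ‖w τ‖) t) t := by
    intro t ht
    obtain ⟨⟨⟨⟨⟨h1, -⟩, -⟩, -⟩, -⟩, h2⟩ := ht₀ t ht
    exact (h1.differentiableAt.norm ℂ (norm_pos_iff.1 h2)).hasDerivAt
  have hH : ∀ t, t₀ ≤ t →
      HasDerivAt H (c / 2 * ‖w t‖ ^ m * deriv (fun τ => ‖w τ‖) t) t := by
    intro t ht
    refine (((hnorm t ht).pow (m + 1)).const_mul (c / 2 / (m + 1 : ℝ))).congr_deriv ?_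
    rw [Nat.add_sub_cancel]
    push_cast
    field_simp
  have hU : ∀ t, t₀ ≤ t → HasDerivAt U ((a * w t ^ m - g t) * w' t * U t) t := by
    intro t ht
    obtain ⟨⟨⟨⟨⟨h1, h2⟩, -⟩, -⟩, -⟩, -⟩ := ht₀ t ht
    refine (h2.mul ((h1.pow (m + 1)).const_mul (a / (m + 1 : ℂ))).cexp).congr_deriv ?_
    simp only [hUdef, Pi.pow_apply, Nat.add_sub_cancel]
    push_cast
    field_simp
    ring
  have hle : ∀ t, t₀ ≤ t → ‖(a * w t ^ m - g t) * w' t * U t‖ ≤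
      c / 2 * ‖w t‖ ^ m * deriv (fun τ => ‖w τ‖) t * ‖U t‖ := by
    intro t ht
    obtain ⟨⟨⟨⟨⟨-, -⟩, h3⟩, -⟩, h5⟩, -⟩ := ht₀ t ht
    rw [norm_mul, norm_mul]
    refine mul_le_mul_of_nonneg_right ?_ (norm_nonneg _)
    calc ‖a * w t ^ m - g t‖ * ‖w' t‖
        ≤ (c / (2 * K) * ‖w t‖ ^ m) * (K * deriv (fun τ => ‖w τ‖) t) :=
          mul_le_mul h3 h5 (norm_nonneg _) (by positivity)
      _ = _ := by field_simp
  refine ⟨‖U t₀‖ * Real.exp (-H t₀), c / 2 / (m + 1), by positivity, ?_⟩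
  filter_upwards [eventually_ge_atTop t₀] with t ht
  have hb := norm_le_mul_exp_of_norm_deriv_le hU hH hle ht
  obtain ⟨⟨⟨⟨⟨-, -⟩, -⟩, h4⟩, -⟩, -⟩ := ht₀ t ht
  have hu' : ‖u t‖ = ‖U t‖ * Real.exp (-((a * w t ^ (m + 1)).re / (m + 1))) := by
    have : a / (m + 1) * w t ^ (m + 1) = ((m + 1 : ℝ)⁻¹ : ℝ) * (a * w t ^ (m + 1)) := by
      push_cast
      field_simp
    simp only [hUdef, norm_mul, Complex.norm_exp, this, Complex.re_ofReal_mul]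
    rw [mul_assoc, ← Real.exp_add]
    simp [div_eq_inv_mul]
  rw [hu']
  calc ‖U t‖ * Real.exp (-((a * w t ^ (m + 1)).re / (m + 1)))
      ≤ ‖U t₀‖ * Real.exp (H t - H t₀) * Real.exp (-((c * ‖w t‖ ^ (m + 1)) / (m + 1))) := by
        gcongr
    _ = _ := by
        rw [mul_assoc, mul_assoc, ← Real.exp_add, ← Real.exp_add]
        congr 2
        simp only [hHdef]
        field_simp
        ring

/-! ### The behaviour of the weight at the ends of an admissible contour -/

/-- The curve has finite length towards its limit point `b` as `t → +∞`, and the weight stays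
bounded on it. -/
structure BoundedEnd (W : ℂ → ℂ) (γ : ℝ → ℂ) (b : ℂ) : Prop where
  tendsto : Tendsto γ atTop (𝓝 b)
  bounded : ∃ C, ∀ᶠ t in atTop, ‖W (γ t)‖ ≤ C
  integrable : IntegrableAtFilter (deriv γ) atTop

/-- The curve tends to infinity with controlled speed, the weight decaying as the exponential of
the power `α` of the distance to the origin. -/
structure DecayingEnd (α : ℕ) (W : ℂ → ℂ) (γ : ℝ → ℂ) : Prop where
  tendsto : Tendsto (fun t => ‖γ t‖) atTop atTop
  decay : ∃ C c : ℝ, 0 < c ∧ ∀ᶠ t in atTop, ‖W (γ t)‖ ≤ C * Real.exp (-(c * ‖γ t‖ ^ α))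
  speed : ∃ K > 0, ∀ᶠ t in atTop, ‖deriv γ t‖ ≤ K * deriv (fun τ => ‖γ τ‖) t

/-- The quotient is the reversed polynomial evaluated at `1 / w`, and its value at `0` is the
leading coefficient. -/
theorem tendsto_eval_div_pow {ι : Type*} {l : Filter ι} {w : ι → ℂ} (P : ℂ[X])
    (hw : Tendsto (fun t => ‖w t‖) l atTop) :
    Tendsto (fun t => P.eval (w t) / w t ^ P.natDegree) l (𝓝 P.leadingCoeff) := by
  have h0 : Tendsto (fun t => (w t)⁻¹) l (𝓝 0) := by
    rw [tendsto_zero_iff_norm_tendsto_zero]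
    simp only [norm_inv]
    exact tendsto_inv_atTop_zero.comp hw
  have h1 := (P.reverse.continuous.tendsto 0).comp h0
  rw [← coeff_zero_eq_eval_zero, coeff_zero_reverse] at h1
  refine h1.congr' ?_
  filter_upwards [hw.eventually_gt_atTop 0] with t ht
  have hne : w t ≠ 0 := norm_pos_iff.1 ht
  have := invertibleOfNonzero hne
  have h2 := eval₂_reverse_mul_pow (RingHom.id ℂ) (w t) P
  simp only [invOf_eq_inv, eval₂_id] at h2
  rw [eq_div_iff (pow_ne_zero _ hne), ← h2]
  rfl

theorem natDegree_add_derivative {A B : ℂ[X]} (hdeg : B.natDegree + 1 ≤ A.natDegree) :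
    (A + derivative B).natDegree = A.natDegree :=
  natDegree_add_eq_left_of_natDegree_lt
    (lt_of_le_of_lt (natDegree_derivative_le B) (by omega))

theorem leadingCoeff_add_derivative {A B : ℂ[X]} (hdeg : B.natDegree + 1 ≤ A.natDegree) :
    (A + derivative B).leadingCoeff = A.leadingCoeff := by
  have : (derivative B).natDegree < A.natDegree :=
    lt_of_le_of_lt (natDegree_derivative_le B) (by omega)
  rw [leadingCoeff, natDegree_add_derivative hdeg, coeff_add,
    coeff_eq_zero_of_natDegree_lt this, add_zero, leadingCoeff]

section Ends

variable {A B : ℂ[X]} {D : Set ℂ} {W : ℂ → ℂ} {γ : ℝ → ℂ}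

theorem hasDerivAt_of_contDiff (hγ : ContDiff ℝ 1 γ) (t : ℝ) : HasDerivAt γ (deriv γ t) t :=
  (hγ.differentiable one_ne_zero t).hasDerivAt

theorem IsWeight.hasDerivAt_comp' (hW : IsWeight A B D W) (hγ : ContDiff ℝ 1 γ)
    (hmem : ∀ t, γ t ∈ D) (t : ℝ) :
    HasDerivAt (fun t => W (γ t)) (deriv W (γ t) * deriv γ t) t := by
  have := (hW.differentiableAt _ (hmem t)).hasDerivAt.scomp t (hasDerivAt_of_contDiff hγ t)
  exact this.congr_deriv (by simp [mul_comm])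

theorem IsWeight.hasDerivAt_comp (hW : IsWeight A B D W) (hγ : ContDiff ℝ 1 γ)
    (hmem : ∀ t, γ t ∈ D) {t : ℝ} (hB : B.eval (γ t) ≠ 0) :
    HasDerivAt (fun t => W (γ t))
      (-((A + derivative B).eval (γ t) / B.eval (γ t) * deriv γ t * W (γ t))) t := by
  refine (hW.hasDerivAt_comp' hγ hmem t).congr_deriv ?_
  have := hW.ode _ (hmem t)
  have h2 : deriv W (γ t) = -((A + derivative B).eval (γ t) * W (γ t)) / B.eval (γ t) := by
    rw [eq_div_iff hB]
    linear_combination this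
  rw [h2]
  ring

theorem IsWeight.continuous_comp (hW : IsWeight A B D W) (hγ : ContDiff ℝ 1 γ)
    (hmem : ∀ t, γ t ∈ D) : Continuous fun t => W (γ t) :=
  continuous_iff_continuousAt.2 fun t => (hW.hasDerivAt_comp' hγ hmem t).continuousAt

theorem IsWeight.bounded_of_mem (hW : IsWeight A B D W) {b : ℂ} (hb : b ∈ D)
    (hγ : Tendsto γ atTop (𝓝 b)) : ∃ C, ∀ᶠ t in atTop, ‖W (γ t)‖ ≤ C := by
  have h := ((hW.differentiableAt b hb).continuousAt.tendsto.comp hγ).norm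
  exact ⟨‖W b‖ + 1, (h.eventually_lt_const (lt_add_one _)).mono fun t ht => ht.le⟩

theorem EndAtInfinity.decayingEnd (hW : IsWeight A B D W) (hB : B ≠ 0)
    (hdeg : B.natDegree + 1 ≤ A.natDegree) (hγ : ContDiff ℝ 1 γ) (hmem : ∀ t, γ t ∈ D)
    (h : EndAtInfinity A B γ) : DecayingEnd (A.natDegree - B.natDegree + 1) W γ := by
  obtain ⟨hinf, ⟨c, hc, hre⟩, K, hK, hspeed⟩ := h
  refine ⟨hinf, ?_, K, hK, hspeed⟩
  have hBt := tendsto_eval_div_pow B hinf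
  have hPt := tendsto_eval_div_pow (A + derivative B) hinf
  rw [natDegree_add_derivative hdeg, leadingCoeff_add_derivative hdeg] at hPt
  have hlc : B.leadingCoeff ≠ 0 := leadingCoeff_ne_zero.2 hB
  have hB0 : ∀ᶠ t in atTop, B.eval (γ t) ≠ 0 := by
    filter_upwards [hBt.eventually_ne hlc] with t ht h0
    exact ht (by simp [h0])
  refine exists_exp_decay (w := γ) (w' := deriv γ) (u := fun t => W (γ t))
    (g := fun t => (A + derivative B).eval (γ t) / B.eval (γ t)) hc hK
    (Eventually.of_forall fun t => hasDerivAt_of_contDiff hγ t)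
    (hB0.mono fun t ht => hW.hasDerivAt_comp hγ hmem ht) hinf ?_ hre hspeed
  refine (hPt.div hBt hlc).congr' ?_
  filter_upwards [hinf.eventually_gt_atTop 0, hB0] with t ht hBt
  have hne : γ t ≠ 0 := norm_pos_iff.1 ht
  have : γ t ^ A.natDegree = γ t ^ (A.natDegree - B.natDegree) * γ t ^ B.natDegree := by
    rw [← pow_add]
    congr 1
    omega
  simp only [Pi.div_apply]
  rw [this]
  field_simp

theorem eval_eq_pow_rootMultiplicity_mul (B : ℂ[X]) (b y : ℂ) :
    B.eval y = (y - b) ^ B.rootMultiplicity b *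
      (B /ₘ (X - C b) ^ B.rootMultiplicity b).eval y := by
  conv_lhs => rw [← pow_mul_divByMonic_rootMultiplicity_eq B b]
  simp

theorem integrableAtFilter_deriv_of_norm_le {γ : ℝ → ℂ} {r r' : ℝ → ℝ} {l : ℝ}
    (hγ : Continuous (deriv γ))
    (hr : ∀ᶠ t in atTop, HasDerivAt r (r' t) t) (hl : Tendsto r atTop (𝓝 l))
    (h : ∀ᶠ t in atTop, ‖deriv γ t‖ ≤ r' t) : IntegrableAtFilter (deriv γ) atTop := by
  obtain ⟨t₀, ht₀⟩ := eventually_atTop.1 (hr.and h)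
  have hi : IntegrableOn r' (Set.Ioi t₀) :=
    integrableOn_Ioi_deriv_of_nonneg' (fun t ht => (ht₀ t ht).1)
      (fun t ht => (norm_nonneg _).trans (ht₀ t (le_of_lt ht)).2) hl
  refine ⟨Set.Ioi t₀, Ioi_mem_atTop t₀, hi.mono' hγ.aestronglyMeasurable ?_⟩
  exact (ae_restrict_iff' measurableSet_Ioi).2
    (Eventually.of_forall fun t ht => (ht₀ t (le_of_lt ht)).2)

theorem EndAtSingularity.boundedEnd (hW : IsWeight A B D W) (hB : B ≠ 0) {b : ℂ}
    (hγ : ContDiff ℝ 1 γ) (hmem : ∀ t, γ t ∈ D)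
    (h : EndAtSingularity A B b γ) : BoundedEnd W γ b := by
  obtain ⟨hm, hb, ⟨c, hc, hre⟩, K, hK, hspeed⟩ := h
  have hroot : B.IsRoot b := (rootMultiplicity_pos hB).1 (by omega)
  obtain ⟨m, hm'⟩ : ∃ m, B.rootMultiplicity b = m + 2 := ⟨_, (Nat.sub_add_cancel hm).symm⟩
  rw [hm'] at hre
  set Q := B /ₘ (X - C b) ^ (m + 2) with hQ
  have hQb : Q.eval b ≠ 0 := by
    have := eval_divByMonic_pow_rootMultiplicity_ne_zero b hB
    rwa [hm'] at this
  have hfac : ∀ y, B.eval y = (y - b) ^ (m + 2) * Q.eval y := fun y => by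
    have := eval_eq_pow_rootMultiplicity_mul B b y
    rwa [hm'] at this
  -- If `b` lies in the domain, the equation for `W` forces `A + B'` to vanish at `b`. The right
  -- side of the sector condition is then `0`, so the condition holds only where `γ t = b` (there
  -- `0⁻¹ = 0`), and the curve is eventually constant.
  by_cases hbD : b ∈ D
  · have hP : (A + derivative B).eval b = 0 := by
      have h1 := hW.ode b hbD
      rw [hroot.eq_zero, zero_mul] at h1
      rcases mul_eq_zero.1 h1.symm with h2 | h2
      · exact neg_eq_zero.1 h2
      · exact absurd h2 (hW.ne_zero b hbD)
    have hconst : ∀ᶠ t in atTop, γ t = b := by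
      filter_upwards [hre] with t ht
      rw [hP] at ht
      by_contra hne
      have : 0 < ‖γ t - b‖ := norm_pos_iff.2 (sub_ne_zero.2 hne)
      have : 0 < c * (‖γ t - b‖ ^ (m + 2 - 1))⁻¹ := by positivity
      simp at ht
      simp at this
      linarith
    obtain ⟨t₀, ht₀⟩ := eventually_atTop.1 hconst
    refine ⟨hb, hW.bounded_of_mem hbD hb, Set.Ioi t₀, Ioi_mem_atTop t₀, ?_⟩
    refine (integrableOn_congr_fun (g := 0) (fun t ht => ?_) measurableSet_Ioi).2
      integrableOn_zero
    have : γ =ᶠ[𝓝 t] fun _ => b := by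
      filter_upwards [Ioi_mem_nhds ht] with s hs using ht₀ s (le_of_lt hs)
    simp [this.deriv_eq]
  · have hne : ∀ t, γ t - b ≠ 0 := fun t h0 => hbD (sub_eq_zero.1 h0 ▸ hmem t)
    have hsub : ∀ t, HasDerivAt (fun t => γ t - b) (deriv γ t) t := fun t =>
      (hasDerivAt_of_contDiff hγ t).sub_const b
    have hnorm : ∀ t, HasDerivAt (fun τ => ‖γ τ - b‖) (deriv (fun τ => ‖γ τ - b‖) t) t :=
      fun t => ((hsub t).differentiableAt.norm ℂ (hne t)).hasDerivAt
    have hlim : Tendsto (fun t => γ t - b) atTop (𝓝 0) := by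
      simpa using hb.sub_const b
    have hinv : Tendsto (fun t => ‖(γ t - b)⁻¹‖) atTop atTop := by
      simp only [norm_inv]
      refine tendsto_inv_nhdsGT_zero.comp
        (tendsto_nhdsWithin_iff.2 ⟨by simpa using hlim.norm, Eventually.of_forall fun t => ?_⟩)
      exact norm_pos_iff.2 (hne t)
    have hQ0 : ∀ᶠ t in atTop, Q.eval (γ t) ≠ 0 :=
      ((Q.continuous.tendsto b).comp hb).eventually_ne hQb
    -- In the variable `w = 1 / (y - b)` one has `dV/dw = -V' (y - b) ^ 2`, which behaves as `a w ^
    -- m` with `a = -(A + B')(b) / Q(b)`.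
    obtain ⟨C, c', hc', hdec⟩ := exists_exp_decay (m := m) (w := fun t => (γ t - b)⁻¹)
      (w' := fun t => -deriv γ t / (γ t - b) ^ 2) (u := fun t => W (γ t))
      (g := fun t => -((A + derivative B).eval (γ t) / B.eval (γ t)) * (γ t - b) ^ 2)
      (a := -((A + derivative B).eval b / Q.eval b)) hc hK
      (Eventually.of_forall fun t => (hsub t).inv (hne t)) (by
        filter_upwards [hQ0] with t ht
        have hBt : B.eval (γ t) ≠ 0 := by
          rw [hfac]
          exact mul_ne_zero (pow_ne_zero _ (hne t)) ht
        refine (hW.hasDerivAt_comp hγ hmem hBt).congr_deriv ?_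
        have := hne t
        field_simp) hinv (by
        have h1 : Tendsto (fun t => -((A + derivative B).eval (γ t) / Q.eval (γ t))) atTop
            (𝓝 (-((A + derivative B).eval b / Q.eval b))) :=
          ((((A + derivative B).continuous.tendsto b).comp hb).div
            ((Q.continuous.tendsto b).comp hb) hQb).neg
        refine h1.congr' ?_
        filter_upwards [hQ0] with t ht
        rw [hfac, inv_pow]
        have := hne t
        field_simp
        ring) (by
        filter_upwards [hre] with t ht
        simpa using ht) (by
        filter_upwards [hspeed] with t ht
        have hn : 0 < ‖γ t - b‖ := norm_pos_iff.2 (hne t)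
        have : deriv (fun τ => ‖(γ τ - b)⁻¹‖) t
            = -deriv (fun τ => ‖γ τ - b‖) t / ‖γ t - b‖ ^ 2 := by
          simp only [norm_inv]
          exact ((hnorm t).inv hn.ne').deriv
        rw [this, norm_div, norm_neg, norm_pow, mul_div_assoc', mul_neg]
        gcongr)
    refine ⟨hb, ⟨|C|, hdec.mono fun t ht => ht.trans ?_⟩, ?_⟩
    · refine (mul_le_mul_of_nonneg_right (le_abs_self C) (Real.exp_pos _).le).trans ?_
      refine mul_le_of_le_one_right (abs_nonneg C) (Real.exp_le_one_iff.2 ?_)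
      have : 0 ≤ c' * ‖(γ t - b)⁻¹‖ ^ (m + 1) := by positivity
      linarith
    · refine integrableAtFilter_deriv_of_norm_le (hγ.continuous_deriv le_rfl)
        (Eventually.of_forall fun t => ((hnorm t).const_mul K).neg) (l := -(K * 0)) ?_ hspeed
      exact ((by simpa using hlim.norm : Tendsto (fun t => ‖γ t - b‖) atTop (𝓝 0)).const_mul
        K).neg

/-- Near `b` the quotient `W / (y - b) ^ k` has the bounded logarithmic derivative `-R / Q`, so
finite length bounds it by Grönwall. -/
theorem EndAtRegular.boundedEnd (hW : IsWeight A B D W) (hB : B ≠ 0) {b : ℂ}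
    (hγ : ContDiff ℝ 1 γ) (hmem : ∀ t, γ t ∈ D)
    (h : EndAtRegular A B b γ) : BoundedEnd W γ b := by
  obtain ⟨hm, ⟨k, hk⟩, hb, hint⟩ := h
  have hroot : B.IsRoot b := (rootMultiplicity_pos hB).1 (by omega)
  refine ⟨hb, ?_, Set.Ici 0, Ici_mem_atTop 0, hint⟩
  by_cases hbD : b ∈ D
  · exact hW.bounded_of_mem hbD hb
  have hne : ∀ t, γ t - b ≠ 0 := fun t h0 => hbD (sub_eq_zero.1 h0 ▸ hmem t)
  set Q := B /ₘ (X - C b) ^ 1 with hQ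
  have hQb : Q.eval b ≠ 0 := by
    have := eval_divByMonic_pow_rootMultiplicity_ne_zero b hB
    rwa [hm] at this
  have hBfac : (X - C b) * Q = B := by
    have := pow_mul_divByMonic_rootMultiplicity_eq B b
    rwa [hm, pow_one, ← pow_one (X - C b), ← hQ, pow_one] at this
  -- As `B'(b) = Q(b)`, the residue condition makes the left side vanish at `b`; hence `V' = -k / (y
  -- - b) + R / Q`.
  obtain ⟨R, hR⟩ : ∃ R, A + derivative B + C (k : ℂ) * Q = (X - C b) * R := by
    refine dvd_iff_isRoot.2 ?_
    have : (derivative B).eval b = Q.eval b := by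
      rw [← hBfac]
      simp
    rw [IsRoot, eval_add, hk, this]
    simp
  have hQ0 : ∀ᶠ t in atTop, Q.eval (γ t) ≠ 0 :=
    ((Q.continuous.tendsto b).comp hb).eventually_ne hQb
  have hRQ : Tendsto (fun t => ‖R.eval (γ t) / Q.eval (γ t)‖) atTop
      (𝓝 ‖R.eval b / Q.eval b‖) :=
    (((R.continuous.tendsto b).comp hb).div ((Q.continuous.tendsto b).comp hb) hQb).norm
  set M := ‖R.eval b / Q.eval b‖ + 1 with hM
  obtain ⟨t₁, ht₁⟩ := eventually_atTop.1
    (hQ0.and (hRQ.eventually_lt_const (lt_add_one _)))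
  set t₀ := max t₁ 0
  have hdγ : Continuous fun t => ‖deriv γ t‖ := (hγ.continuous_deriv le_rfl).norm
  set H : ℝ → ℝ := fun t => M * ∫ τ in (0 : ℝ)..t, ‖deriv γ τ‖ with hH
  have hHder : ∀ t, HasDerivAt H (M * ‖deriv γ t‖) t := fun t =>
    (hdγ.integral_hasStrictDerivAt 0 t).hasDerivAt.const_mul M
  have hu : ∀ t, t₀ ≤ t → HasDerivAt (fun t => W (γ t) / (γ t - b) ^ k)
      (-(R.eval (γ t) / Q.eval (γ t)) * deriv γ t * (W (γ t) / (γ t - b) ^ k)) t := by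
    intro t ht
    have hQt := (ht₁ t ((le_max_left _ _).trans ht)).1
    have hBe : B.eval (γ t) = (γ t - b) * Q.eval (γ t) := by
      rw [← hBfac]
      simp
    have hBt : B.eval (γ t) ≠ 0 := by
      rw [hBe]
      exact mul_ne_zero (hne t) hQt
    have hPe : (A + derivative B).eval (γ t) = (γ t - b) * R.eval (γ t) - k * Q.eval (γ t) := by
      have := congrArg (eval (γ t)) hR
      simp only [eval_add, eval_mul, eval_sub, eval_X, eval_C] at this ⊢
      linear_combination this
    have h1 := (hW.hasDerivAt_comp hγ hmem hBt).div
      (((hasDerivAt_of_contDiff hγ t).sub_const b).pow k) (pow_ne_zero k (hne t))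
    refine h1.congr_deriv ?_
    rw [hPe, hBe]
    have hn := hne t
    simp only [Pi.pow_apply]
    rcases k with _ | k
    · simp
      field_simp
      simp
    · rw [Nat.add_sub_cancel]
      push_cast
      field_simp
      ring
  have hle : ∀ t, t₀ ≤ t → ‖-(R.eval (γ t) / Q.eval (γ t)) * deriv γ t *
      (W (γ t) / (γ t - b) ^ k)‖ ≤ M * ‖deriv γ t‖ * ‖W (γ t) / (γ t - b) ^ k‖ := by
    intro t ht
    rw [norm_mul, norm_mul, norm_neg]
    gcongr
    exact (ht₁ t ((le_max_left _ _).trans ht)).2.le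
  set I := ∫ τ in Set.Ioi (0 : ℝ), ‖deriv γ τ‖
  have hI : ∀ t, 0 ≤ t → H t ≤ M * I := by
    intro t ht
    refine mul_le_mul_of_nonneg_left ?_ (by positivity)
    rw [intervalIntegral.integral_of_le ht]
    exact setIntegral_mono_set (hint.mono_set Set.Ioi_subset_Ici_self).norm
      (Eventually.of_forall fun _ => norm_nonneg _)
      (Eventually.of_forall Set.Ioc_subset_Ioi_self)
  have hpow : ∀ᶠ t in atTop, ‖(γ t - b) ^ k‖ ≤ 1 := by
    have : Tendsto (fun t => ‖γ t - b‖) atTop (𝓝 0) := by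
      simpa using (hb.sub_const b).norm
    filter_upwards [this.eventually_lt_const one_pos] with t ht
    rw [norm_pow]
    exact pow_le_one₀ (norm_nonneg _) ht.le
  refine ⟨‖W (γ t₀) / (γ t₀ - b) ^ k‖ * Real.exp (M * I - H t₀), ?_⟩
  filter_upwards [hpow, eventually_ge_atTop t₀] with t h1 h2
  have h3 := norm_le_mul_exp_of_norm_deriv_le hu (fun t _ => hHder t) hle h2
  have h4 : ‖W (γ t)‖ = ‖W (γ t) / (γ t - b) ^ k‖ * ‖(γ t - b) ^ k‖ := by
    rw [← norm_mul, div_mul_cancel₀ _ (pow_ne_zero k (hne t))]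
  rw [h4]
  refine (mul_le_of_le_one_right (norm_nonneg _) h1).trans (h3.trans ?_)
  gcongr
  exact hI t ((le_max_right _ _).trans h2)

theorem AdmissibleEnd.boundedEnd_or_decayingEnd (hW : IsWeight A B D W) (hB : B ≠ 0)
    (hdeg : B.natDegree + 1 ≤ A.natDegree) (hγ : ContDiff ℝ 1 γ) (hmem : ∀ t, γ t ∈ D)
    (h : AdmissibleEnd A B γ) :
    (∃ b, B.IsRoot b ∧ BoundedEnd W γ b) ∨
      DecayingEnd (A.natDegree - B.natDegree + 1) W γ := by
  rcases h with h | ⟨b, h⟩ | ⟨b, h⟩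
  · exact Or.inr (h.decayingEnd hW hB hdeg hγ hmem)
  · refine Or.inl ⟨b, (rootMultiplicity_pos hB).1 ?_, h.boundedEnd hW hB hγ hmem⟩
    have := h.1
    omega
  · refine Or.inl ⟨b, (rootMultiplicity_pos hB).1 ?_, h.boundedEnd hW hB hγ hmem⟩
    have := h.1
    omega

end Ends

/-! ### Functions of subgaussian growth -/

/-- Growth slower than every Gaussian. -/
def Subgaussian (f : ℂ → ℂ) : Prop :=
  ∀ ε > 0, ∃ C, ∀ y, ‖f y‖ ≤ C * Real.exp (ε * ‖y‖ ^ 2)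

theorem Subgaussian.mul {f g : ℂ → ℂ} (hf : Subgaussian f) (hg : Subgaussian g) :
    Subgaussian fun y => f y * g y := by
  intro ε hε
  obtain ⟨C, hC⟩ := hf (ε / 2) (half_pos hε)
  obtain ⟨C', hC'⟩ := hg (ε / 2) (half_pos hε)
  refine ⟨C * C', fun y => ?_⟩
  have h := mul_le_mul (hC y) (hC' y) (norm_nonneg _) ((norm_nonneg _).trans (hC y))
  rw [norm_mul]
  refine h.trans (le_of_eq ?_)
  rw [mul_mul_mul_comm, ← Real.exp_add]
  ring_nf

theorem Subgaussian.add {f g : ℂ → ℂ} (hf : Subgaussian f) (hg : Subgaussian g) :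
    Subgaussian fun y => f y + g y := by
  intro ε hε
  obtain ⟨C, hC⟩ := hf ε hε
  obtain ⟨C', hC'⟩ := hg ε hε
  refine ⟨C + C', fun y => (norm_add_le _ _).trans ?_⟩
  rw [add_mul]
  exact add_le_add (hC y) (hC' y)

theorem Subgaussian.exp_mul (x : ℂ) : Subgaussian fun y => Complex.exp (x * y) := by
  intro ε hε
  refine ⟨Real.exp (‖x‖ ^ 2 / (4 * ε)), fun y => ?_⟩
  rw [Complex.norm_exp, ← Real.exp_add, Real.exp_le_exp]
  refine (Complex.re_le_norm _).trans ?_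
  rw [norm_mul]
  have h : ‖x‖ ^ 2 / (4 * ε) + ε * ‖y‖ ^ 2 - ‖x‖ * ‖y‖ = (‖x‖ - 2 * ε * ‖y‖) ^ 2 / (4 * ε) := by
    field_simp
    ring
  have : 0 ≤ (‖x‖ - 2 * ε * ‖y‖) ^ 2 / (4 * ε) := by positivity
  linarith

theorem Subgaussian.const (a : ℂ) : Subgaussian fun _ => a := by
  intro ε hε
  refine ⟨‖a‖, fun y => le_mul_of_one_le_right (norm_nonneg _) (Real.one_le_exp ?_)⟩
  positivity

theorem Subgaussian.id : Subgaussian fun y => y := by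
  intro ε hε
  refine ⟨1 / (4 * ε) + 1, fun y => ?_⟩
  have h1 : ε * ‖y‖ ^ 2 + 1 ≤ Real.exp (ε * ‖y‖ ^ 2) := Real.add_one_le_exp _
  have h2 : 1 / (4 * ε) + ε * ‖y‖ ^ 2 - ‖y‖ = (1 - 2 * ε * ‖y‖) ^ 2 / (4 * ε) := by
    field_simp
    ring
  have h3 : 0 ≤ (1 - 2 * ε * ‖y‖) ^ 2 / (4 * ε) := by positivity
  have h4 : 0 < 1 / (4 * ε) := by positivity
  have h5 : 0 ≤ ε * ‖y‖ ^ 2 := by positivity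
  nlinarith

theorem Subgaussian.eval (P : ℂ[X]) : Subgaussian fun y => P.eval y := by
  induction P using Polynomial.induction_on' with
  | add p q hp hq =>
    simp only [eval_add]
    exact hp.add hq
  | monomial n a =>
    simp only [eval_monomial]
    refine (Subgaussian.const a).mul ?_
    induction n with
    | zero => simpa using Subgaussian.const 1
    | succ n ih =>
      simp only [pow_succ]
      exact ih.mul Subgaussian.id

/-- Quadratic decay absorbs a Gaussian with small constant, and decay of order at least three
absorbs every Gaussian. A factor `exp (-r)` is left over to force convergence. -/
theorem eventually_gaussian_sub_le {ι : Type*} {l : Filter ι} {r : ι → ℝ} {α : ℕ} (hα : 2 ≤ α)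
    {c N : ℝ} (hc : 0 < c) (hN : N ≤ c / 2 ∨ 3 ≤ α) (hr : Tendsto r l atTop) :
    ∀ᶠ t in l, N * r t ^ 2 - c * r t ^ α ≤ -r t := by
  rcases hN with hN | hN
  · filter_upwards [hr.eventually_ge_atTop 1, hr.eventually_ge_atTop (2 / c)] with t h1 h2
    have h3 : r t ^ 2 ≤ r t ^ α := pow_le_pow_right₀ h1 hα
    rw [div_le_iff₀ hc] at h2
    have h4 : c * r t ^ 2 ≤ c * r t ^ α := mul_le_mul_of_nonneg_left h3 hc.le
    have h5 : N * r t ^ 2 ≤ c / 2 * r t ^ 2 := mul_le_mul_of_nonneg_right hN (sq_nonneg _)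
    nlinarith
  · filter_upwards [hr.eventually_ge_atTop 1, hr.eventually_ge_atTop ((N + 1) / c)] with t h1 h2
    have h3 : r t ^ 3 ≤ r t ^ α := pow_le_pow_right₀ h1 hN
    rw [div_le_iff₀ hc] at h2
    have h4 : c * r t ^ 3 ≤ c * r t ^ α := mul_le_mul_of_nonneg_left h3 hc.le
    have h5 : (N + 1) * r t ^ 2 ≤ r t * c * r t ^ 2 :=
      mul_le_mul_of_nonneg_right h2 (sq_nonneg _)
    nlinarith

/-! ### Integrability at the ends of a contour and vanishing of boundary terms -/

section Ends

variable {A B : ℂ[X]} {D : Set ℂ} {W : ℂ → ℂ} {γ : ℝ → ℂ} {α : ℕ} {b : ℂ}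

theorem integrableAtFilter_mul_of_bounded {g h : ℝ → ℝ} {C : ℝ} (hg : Continuous g)
    (hC : ∀ᶠ t in atTop, ‖g t‖ ≤ C) (hh : IntegrableAtFilter h atTop) :
    IntegrableAtFilter (fun t => g t * h t) atTop := by
  obtain ⟨s, hs, hi⟩ := hh
  obtain ⟨t₀, ht₀⟩ := eventually_atTop.1 (hC.and hs)
  refine ⟨Set.Ici t₀, Ici_mem_atTop t₀, ?_⟩
  have hi' : IntegrableOn h (Set.Ici t₀) := hi.mono_set fun t ht => (ht₀ t ht).2
  exact Integrable.bdd_mul (c := C) hi' hg.aestronglyMeasurable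
    ((ae_restrict_iff' measurableSet_Ici).2 (Eventually.of_forall fun t ht => (ht₀ t ht).1))

theorem continuous_gaussian_mul_norm (hγ : Continuous γ) (hWγ : Continuous fun t => W (γ t))
    (N : ℝ) : Continuous fun t => Real.exp (N * ‖γ t‖ ^ 2) * ‖W (γ t)‖ :=
  (Real.continuous_exp.comp (continuous_const.mul (hγ.norm.pow 2))).mul hWγ.norm

theorem BoundedEnd.integrableAtFilter (h : BoundedEnd W γ b) (hγ : Continuous γ)
    (hWγ : Continuous fun t => W (γ t)) (N : ℝ) :
    IntegrableAtFilter (fun t => Real.exp (N * ‖γ t‖ ^ 2) * ‖W (γ t)‖ * ‖deriv γ t‖) atTop := by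
  obtain ⟨C, hC⟩ := h.bounded
  have h1 : Tendsto (fun t => Real.exp (N * ‖γ t‖ ^ 2)) atTop
      (𝓝 (Real.exp (N * ‖b‖ ^ 2))) :=
    (Real.continuous_exp.tendsto _).comp ((h.tendsto.norm.pow 2).const_mul N)
  refine integrableAtFilter_mul_of_bounded (C := (Real.exp (N * ‖b‖ ^ 2) + 1) * C)
    (continuous_gaussian_mul_norm hγ hWγ N) ?_ ?_
  · filter_upwards [hC, h1.eventually_lt_const (lt_add_one _)] with t h2 h3
    rw [norm_mul, norm_norm, Real.norm_of_nonneg (Real.exp_pos _).le]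
    exact mul_le_mul h3.le h2 (norm_nonneg _) (by positivity)
  · obtain ⟨s, hs, hi⟩ := h.integrable
    exact ⟨s, hs, hi.norm⟩

/-- The speed condition dominates the integrand by the derivative of `-|C| K exp (-‖γ‖)`, a function
with a finite limit. -/
theorem DecayingEnd.integrableAtFilter (h : DecayingEnd α W γ) (hα : 2 ≤ α)
    (hγ : ContDiff ℝ 1 γ) (hWγ : Continuous fun t => W (γ t)) :
    ∃ ε > 0, ∀ N, (N ≤ ε ∨ 3 ≤ α) → IntegrableAtFilter
      (fun t => Real.exp (N * ‖γ t‖ ^ 2) * ‖W (γ t)‖ * ‖deriv γ t‖) atTop := by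
  obtain ⟨C, c, hc, hdec⟩ := h.decay
  obtain ⟨K, hK, hspeed⟩ := h.speed
  refine ⟨c / 2, half_pos hc, fun N hN => ?_⟩
  have hlim : Tendsto (fun t => -(|C| * K * Real.exp (-‖γ t‖))) atTop (𝓝 (-(|C| * K * 0))) :=
    ((Real.tendsto_exp_neg_atTop_nhds_zero.comp h.tendsto).const_mul _).neg
  have hder : ∀ᶠ t in atTop, HasDerivAt (fun t => -(|C| * K * Real.exp (-‖γ t‖)))
      (|C| * K * Real.exp (-‖γ t‖) * deriv (fun τ => ‖γ τ‖) t) t := by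
    filter_upwards [h.tendsto.eventually_gt_atTop 0] with t ht
    have h1 : HasDerivAt (fun τ => ‖γ τ‖) (deriv (fun τ => ‖γ τ‖) t) t :=
      ((hasDerivAt_of_contDiff hγ t).differentiableAt.norm ℂ (norm_pos_iff.1 ht)).hasDerivAt
    refine ((h1.neg.exp.const_mul (|C| * K)).neg).congr_deriv ?_
    simp only [Pi.neg_apply]
    ring
  have hle : ∀ᶠ t in atTop, Real.exp (N * ‖γ t‖ ^ 2) * ‖W (γ t)‖ * ‖deriv γ t‖ ≤
      |C| * K * Real.exp (-‖γ t‖) * deriv (fun τ => ‖γ τ‖) t := by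
    filter_upwards [hdec, hspeed, eventually_gaussian_sub_le hα hc hN h.tendsto] with t h1 h2 h3
    have h4 : Real.exp (N * ‖γ t‖ ^ 2) * ‖W (γ t)‖ ≤ |C| * Real.exp (-‖γ t‖) := by
      calc Real.exp (N * ‖γ t‖ ^ 2) * ‖W (γ t)‖
          ≤ Real.exp (N * ‖γ t‖ ^ 2) * (|C| * Real.exp (-(c * ‖γ t‖ ^ α))) := by
            gcongr
            exact h1.trans (mul_le_mul_of_nonneg_right (le_abs_self C) (Real.exp_pos _).le)
        _ = |C| * Real.exp (N * ‖γ t‖ ^ 2 - c * ‖γ t‖ ^ α) := by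
            rw [mul_left_comm, ← Real.exp_add, sub_eq_add_neg]
        _ ≤ _ := by gcongr
    calc _ ≤ |C| * Real.exp (-‖γ t‖) * (K * deriv (fun τ => ‖γ τ‖) t) :=
          mul_le_mul h4 h2 (norm_nonneg _) (by positivity)
      _ = _ := by ring
  obtain ⟨t₀, ht₀⟩ := eventually_atTop.1 (hder.and hle)
  have hi := integrableOn_Ioi_deriv_of_nonneg' (fun t ht => (ht₀ t ht).1)
    (fun t ht => (by positivity : (0 : ℝ) ≤ _).trans (ht₀ t (le_of_lt ht)).2) hlim
  refine ⟨Set.Ioi t₀, Ioi_mem_atTop t₀,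
    hi.mono' ((continuous_gaussian_mul_norm hγ.continuous hWγ N).mul
      (hγ.continuous_deriv le_rfl).norm).aestronglyMeasurable ?_⟩
  refine (ae_restrict_iff' measurableSet_Ioi).2 (Eventually.of_forall fun t ht => ?_)
  rw [Real.norm_of_nonneg (by positivity)]
  exact (ht₀ t (le_of_lt ht)).2

theorem BoundedEnd.tendsto_zero (h : BoundedEnd W γ b) (hb : B.IsRoot b) {f : ℂ → ℂ}
    (hf : Continuous f) : Tendsto (fun t => f (γ t) * B.eval (γ t) * W (γ t)) atTop (𝓝 0) := by
  obtain ⟨C, hC⟩ := h.bounded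
  have h1 : Tendsto (fun t => f (γ t) * B.eval (γ t)) atTop (𝓝 0) := by
    have := ((hf.tendsto b).comp h.tendsto).mul ((B.continuous.tendsto b).comp h.tendsto)
    rwa [hb.eq_zero, mul_zero] at this
  refine h1.zero_mul_isBoundedUnder_le ?_
  exact ⟨C, by simpa using hC⟩

theorem DecayingEnd.tendsto_zero (h : DecayingEnd α W γ) (hα : 2 ≤ α) {f : ℂ → ℂ}
    (hf : Subgaussian f) : Tendsto (fun t => f (γ t) * W (γ t)) atTop (𝓝 0) := by
  obtain ⟨C, c, hc, hdec⟩ := h.decay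
  obtain ⟨C', hC'⟩ := hf (c / 2) (half_pos hc)
  have hlim : Tendsto (fun t => C' * |C| * Real.exp (-‖γ t‖)) atTop (𝓝 0) := by
    simpa using (Real.tendsto_exp_neg_atTop_nhds_zero.comp h.tendsto).const_mul (C' * |C|)
  refine squeeze_zero_norm' ?_ hlim
  filter_upwards [hdec, eventually_gaussian_sub_le hα hc (Or.inl le_rfl) h.tendsto] with t h1 h3
  have hC0 : 0 ≤ C' := by
    have := (norm_nonneg _).trans (hC' 0)
    simpa using this
  rw [norm_mul]
  calc ‖f (γ t)‖ * ‖W (γ t)‖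
      ≤ (C' * Real.exp (c / 2 * ‖γ t‖ ^ 2)) * (|C| * Real.exp (-(c * ‖γ t‖ ^ α))) := by
        gcongr
        · exact hC' _
        · exact h1.trans (mul_le_mul_of_nonneg_right (le_abs_self C) (Real.exp_pos _).le)
    _ = C' * |C| * Real.exp (c / 2 * ‖γ t‖ ^ 2 - c * ‖γ t‖ ^ α) := by
        rw [mul_mul_mul_comm, ← Real.exp_add, sub_eq_add_neg]
    _ ≤ _ := by gcongr

/-! ### Admissible contours -/

theorem integrable_of_integrableAtFilter_atTop {g : ℝ → ℝ} (hg : Continuous g)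
    (h : IntegrableAtFilter g atTop) (h' : IntegrableAtFilter (fun t => g (-t)) atTop) :
    Integrable g := by
  refine integrable_iff_integrableAtFilter_atBot_atTop.2 ⟨⟨?_, h⟩, hg.locallyIntegrable⟩
  obtain ⟨s, hs, hi⟩ := h'
  refine ⟨Neg.neg ⁻¹' s, tendsto_neg_atBot_atTop hs, ?_⟩
  have := ((Measure.measurePreserving_neg (volume : Measure ℝ)).integrableOn_comp_preimage
    (MeasurableEquiv.neg ℝ).measurableEmbedding (f := fun t => g (-t)) (s := s)).2 hi
  refine this.congr_fun_ae (Eventually.of_forall fun t => ?_)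
  simp

/-- A small Gaussian factor is always affordable, since `deg A - deg B + 1 ≥ 2`; any Gaussian is
when the potential grows faster than quadratically. The double integrals need this distinction. -/
theorem IsAdmissible.integrable_gaussian (hW : IsWeight A B D W) (hB : B ≠ 0)
    (hdeg : B.natDegree + 1 ≤ A.natDegree) (h : IsAdmissible A B D γ) :
    ∃ ε > 0, ∀ N, (N ≤ ε ∨ B.natDegree + 2 ≤ A.natDegree) → Integrable
      (fun t => Real.exp (N * ‖γ t‖ ^ 2) * ‖W (γ t)‖ * ‖deriv γ t‖) := by
  have key : ∀ γ : ℝ → ℂ, ContDiff ℝ 1 γ → (∀ t, γ t ∈ D) →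
      ((∃ b, BoundedEnd W γ b) ∨ DecayingEnd (A.natDegree - B.natDegree + 1) W γ) →
      ∃ ε > 0, ∀ N, (N ≤ ε ∨ B.natDegree + 2 ≤ A.natDegree) → IntegrableAtFilter
        (fun t => Real.exp (N * ‖γ t‖ ^ 2) * ‖W (γ t)‖ * ‖deriv γ t‖) atTop := by
    intro γ hγ hmem hend
    have hWγ := hW.continuous_comp hγ hmem
    rcases hend with ⟨b, hb⟩ | hd
    · exact ⟨1, one_pos, fun N _ => hb.integrableAtFilter hγ.continuous hWγ N⟩
    · obtain ⟨ε, hε, hi⟩ := hd.integrableAtFilter (by omega) hγ hWγ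
      exact ⟨ε, hε, fun N hN => hi N (hN.imp_right fun _ => by omega)⟩
  have hγ' : ContDiff ℝ 1 fun t => γ (-t) := h.contDiff.comp contDiff_neg
  have hend : ((∃ b, BoundedEnd W γ b) ∨ DecayingEnd (A.natDegree - B.natDegree + 1) W γ) ∧
      ((∃ b, BoundedEnd W (fun t => γ (-t)) b) ∨
        DecayingEnd (A.natDegree - B.natDegree + 1) W fun t => γ (-t)) := by
    rcases h.ends with ⟨⟨p, hp, hbot, htop⟩, hi⟩ | ⟨h1, h2⟩
    · refine ⟨Or.inl ⟨p, htop, hW.bounded_of_mem hp htop, _, univ_mem, hi.integrableOn⟩,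
        Or.inl ⟨p, hbot.comp tendsto_neg_atTop_atBot,
          hW.bounded_of_mem hp (hbot.comp tendsto_neg_atTop_atBot), _, univ_mem, ?_⟩⟩
      rw [show (deriv fun t => γ (-t)) = fun t => -deriv γ (-t) from
        funext fun t => deriv_comp_neg γ t]
      exact hi.comp_neg.neg.integrableOn
    · exact ⟨(h1.boundedEnd_or_decayingEnd hW hB hdeg h.contDiff h.mem).imp_left
          fun ⟨b, hb⟩ => ⟨b, hb.2⟩,
        (h2.boundedEnd_or_decayingEnd hW hB hdeg hγ' fun t => h.mem _).imp_left
          fun ⟨b, hb⟩ => ⟨b, hb.2⟩⟩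
  obtain ⟨ε, hε, h1⟩ := key γ h.contDiff h.mem hend.1
  obtain ⟨ε', hε', h2⟩ := key _ hγ' (fun t => h.mem _) hend.2
  refine ⟨min ε ε', lt_min hε hε', fun N hN => ?_⟩
  refine integrable_of_integrableAtFilter_atTop ((continuous_gaussian_mul_norm
    h.contDiff.continuous (hW.continuous_comp h.contDiff h.mem) N).mul
      (h.contDiff.continuous_deriv le_rfl).norm)
    (h1 N (hN.imp_left fun h => h.trans (min_le_left _ _))) ?_
  have := h2 N (hN.imp_left fun h => h.trans (min_le_right _ _))
  simpa only [deriv_comp_neg, norm_neg] using this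

theorem IsAdmissible.integrable (hW : IsWeight A B D W) (hB : B ≠ 0)
    (hdeg : B.natDegree + 1 ≤ A.natDegree) (h : IsAdmissible A B D γ) {f : ℂ → ℂ}
    (hf : Continuous f) (hf' : Subgaussian f) :
    Integrable fun t => f (γ t) * W (γ t) * deriv γ t := by
  obtain ⟨ε, hε, hi⟩ := h.integrable_gaussian hW hB hdeg
  obtain ⟨C, hC⟩ := hf' ε hε
  refine ((hi ε (Or.inl le_rfl)).const_mul C).mono' (((hf.comp h.contDiff.continuous).mul
    (hW.continuous_comp h.contDiff h.mem)).mul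
      (h.contDiff.continuous_deriv le_rfl)).aestronglyMeasurable
    (Eventually.of_forall fun t => ?_)
  rw [norm_mul, norm_mul, ← mul_assoc, ← mul_assoc]
  gcongr
  exact hC _

/-- A closed curve has the same boundary value at both ends. At any other end the limit is `0`:
either `B` vanishes at the limit point while the weight is bounded, or the weight decays. -/
theorem IsAdmissible.exists_tendsto (hW : IsWeight A B D W) (hB : B ≠ 0)
    (hdeg : B.natDegree + 1 ≤ A.natDegree) (h : IsAdmissible A B D γ) {f : ℂ → ℂ}
    (hf : Continuous f) (hf' : Subgaussian f) :
    ∃ l, Tendsto (fun t => f (γ t) * B.eval (γ t) * W (γ t)) atBot (𝓝 l) ∧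
      Tendsto (fun t => f (γ t) * B.eval (γ t) * W (γ t)) atTop (𝓝 l) := by
  rcases h.ends with ⟨⟨p, hp, hbot, htop⟩, -⟩ | ⟨h1, h2⟩
  · have hc : Tendsto (fun y => f y * B.eval y * W y) (𝓝 p) (𝓝 (f p * B.eval p * W p)) :=
      ((hf.mul B.continuous).tendsto p).mul (hW.differentiableAt p hp).continuousAt
    exact ⟨_, hc.comp hbot, hc.comp htop⟩
  · have key : ∀ γ : ℝ → ℂ, ((∃ b, B.IsRoot b ∧ BoundedEnd W γ b) ∨
        DecayingEnd (A.natDegree - B.natDegree + 1) W γ) →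
        Tendsto (fun t => f (γ t) * B.eval (γ t) * W (γ t)) atTop (𝓝 0) := by
      rintro γ (⟨b, hb, he⟩ | hd)
      · exact he.tendsto_zero hb hf
      · exact hd.tendsto_zero (by omega) (hf'.mul (Subgaussian.eval B))
    refine ⟨0, ?_, key γ (h1.boundedEnd_or_decayingEnd hW hB hdeg h.contDiff h.mem)⟩
    have := (key _ (h2.boundedEnd_or_decayingEnd hW hB hdeg (h.contDiff.comp contDiff_neg)
      fun t => h.mem _)).comp tendsto_neg_atBot_atTop
    simpa only [Function.comp_def, neg_neg] using this

/-- Integration by parts along an admissible contour. -/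
theorem IsAdmissible.lineInt_exp_mul (hW : IsWeight A B D W) (hB : B ≠ 0)
    (hdeg : B.natDegree + 1 ≤ A.natDegree) (h : IsAdmissible A B D γ) (x : ℂ) (T : ℂ[X]) :
    lineInt γ (fun y => Complex.exp (x * y) * (B * derivative T - A * T).eval y * W y)
      = -x * lineInt γ (fun y => Complex.exp (x * y) * (B * T).eval y * W y) := by
  have hexp : Continuous fun y : ℂ => Complex.exp (x * y) := by fun_prop
  have hint : ∀ P : ℂ[X], Integrable fun t =>
      Complex.exp (x * γ t) * P.eval (γ t) * W (γ t) * deriv γ t := fun P =>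
    h.integrable (f := fun y => Complex.exp (x * y) * P.eval y) hW hB hdeg
      (hexp.mul P.continuous) ((Subgaussian.exp_mul x).mul (.eval P))
  obtain ⟨l, hbot, htop⟩ := h.exists_tendsto (f := fun y => Complex.exp (x * y) * T.eval y)
    hW hB hdeg (hexp.mul T.continuous) ((Subgaussian.exp_mul x).mul (.eval T))
  have hder : ∀ t, HasDerivAt
      (fun t => Complex.exp (x * γ t) * T.eval (γ t) * B.eval (γ t) * W (γ t))
      (Complex.exp (x * γ t) * (B * derivative T - A * T).eval (γ t) * W (γ t) * deriv γ t
        + x * (Complex.exp (x * γ t) * (B * T).eval (γ t) * W (γ t) * deriv γ t)) t := by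
    intro t
    have hγ := hasDerivAt_of_contDiff h.contDiff t
    have hp : ∀ P : ℂ[X], HasDerivAt (fun t => P.eval (γ t))
        ((derivative P).eval (γ t) * deriv γ t) t := fun P => by
      have := (P.hasDerivAt (γ t)).scomp t hγ
      exact this.congr_deriv (by simp [mul_comm])
    have h1 := (((hγ.const_mul x).cexp.mul (hp T)).mul (hp B)).mul
      (hW.hasDerivAt_comp' h.contDiff h.mem t)
    refine h1.congr_deriv ?_
    -- The equation for `W` cancels the term `T B'`: the derivative of `T B W` is `(B T' - A T) W`.
    have ho := hW.ode _ (h.mem t)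
    simp only [eval_mul, eval_sub, eval_add, Pi.mul_apply] at ho ⊢
    linear_combination (Complex.exp (x * γ t) * T.eval (γ t) * deriv γ t) * ho
  have h0 := integral_of_hasDerivAt_of_tendsto hder ((hint _).add ((hint _).const_mul x)) hbot htop
  rw [sub_self, integral_add (hint _) ((hint _).const_mul x), integral_const_mul] at h0
  rw [lineInt, lineInt]
  linear_combination h0

end Ends

/-! ### Absolute convergence of the double integrals -/

/-- The integrand `F` is absolutely integrable over the products of contours that occur in
`∬_κ`. -/
def Data.DblIntegrable (S : Data) (F : ℂ → ℂ → ℂ) : Prop :=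
  ∀ μ ν, S.κ μ ν ≠ 0 → Integrable fun q : ℝ × ℝ =>
    F (S.Γx μ q.1) (S.Γy ν q.2) * (deriv (S.Γx μ) q.1 * deriv (S.Γy ν) q.2)

theorem lineInt_lineInt_eq {γ η : ℝ → ℂ} {F : ℂ → ℂ → ℂ} (h : Integrable fun q : ℝ × ℝ =>
      F (γ q.1) (η q.2) * (deriv γ q.1 * deriv η q.2)) :
    lineInt γ (fun ξ => lineInt η (F ξ)) =
      ∫ q : ℝ × ℝ, F (γ q.1) (η q.2) * (deriv γ q.1 * deriv η q.2) := by
  rw [Measure.volume_eq_prod] at h ⊢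
  rw [integral_prod _ h, lineInt]
  refine integral_congr_ae (Eventually.of_forall fun a => ?_)
  simp only [lineInt]
  rw [← integral_mul_const]
  refine integral_congr_ae (Eventually.of_forall fun b => ?_)
  ring

theorem lineInt_const_mul (γ : ℝ → ℂ) (c : ℂ) (f : ℂ → ℂ) :
    lineInt γ (fun y => c * f y) = c * lineInt γ f := by
  simp only [lineInt, mul_assoc, integral_const_mul]

theorem lineInt_congr {γ : ℝ → ℂ} {f g : ℂ → ℂ} (h : ∀ t, f (γ t) = g (γ t)) :
    lineInt γ f = lineInt γ g := by
  simp only [lineInt, h]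

theorem Data.dbl_congr (S : Data) {F G : ℂ → ℂ → ℂ}
    (h : ∀ μ ν t t', F (S.Γx μ t) (S.Γy ν t') = G (S.Γx μ t) (S.Γy ν t')) :
    S.dbl F = S.dbl G :=
  Finset.sum_congr rfl fun μ _ => Finset.sum_congr rfl fun ν _ => congrArg _ <|
    lineInt_congr fun t => lineInt_congr fun t' => h μ ν t t'

theorem Data.dbl_const_mul (S : Data) (c : ℂ) (F : ℂ → ℂ → ℂ) :
    S.dbl (fun ξ y => c * F ξ y) = c * S.dbl F := by
  simp only [Data.dbl, lineInt_const_mul, Finset.mul_sum]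
  exact Finset.sum_congr rfl fun μ _ => Finset.sum_congr rfl fun ν _ => by ring

theorem Data.dbl_add (S : Data) {F G : ℂ → ℂ → ℂ} (hF : S.DblIntegrable F)
    (hG : S.DblIntegrable G) : S.dbl (fun ξ y => F ξ y + G ξ y) = S.dbl F + S.dbl G := by
  simp only [Data.dbl, ← Finset.sum_add_distrib]
  refine Finset.sum_congr rfl fun μ _ => Finset.sum_congr rfl fun ν _ => ?_
  -- Absolute convergence is available only for the pairs of contours that occur in the functional.
  by_cases hκ : S.κ μ ν = 0
  · simp [hκ]
  have h1 := hF μ ν hκ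
  have h2 := hG μ ν hκ
  have h3 : Integrable fun q : ℝ × ℝ => (F (S.Γx μ q.1) (S.Γy ν q.2)
      + G (S.Γx μ q.1) (S.Γy ν q.2)) * (deriv (S.Γx μ) q.1 * deriv (S.Γy ν) q.2) := by
    simp only [add_mul]
    exact h1.add h2
  rw [← mul_add, lineInt_lineInt_eq h1, lineInt_lineInt_eq h2,
    lineInt_lineInt_eq (F := fun ξ y => F ξ y + G ξ y) h3, ← integral_add h1 h2]
  simp only [add_mul]

theorem Data.DblIntegrable.const_mul {S : Data} {F : ℂ → ℂ → ℂ} (hF : S.DblIntegrable F)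
    (c : ℂ) : S.DblIntegrable fun ξ y => c * F ξ y := fun μ ν hκ => by
  simpa only [mul_assoc] using (hF μ ν hκ).const_mul c

theorem Data.continuous_W₁ (S : Data) (μ) : Continuous fun t => S.W₁ (S.Γx μ t) :=
  S.isWeight₁.continuous_comp (S.admissible_x μ).contDiff (S.admissible_x μ).mem

theorem Data.continuous_W₂ (S : Data) (ν) : Continuous fun t => S.W₂ (S.Γy ν t) :=
  S.isWeight₂.continuous_comp (S.admissible_y ν).contDiff (S.admissible_y ν).mem

/-- The bound `|ξ y| ≤ δ |ξ|² + |y|² / (4δ)` separates the variables. The additional `δ` and `η` pay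
for the powers of `ξ` and `y`. -/
theorem Data.integrable_moment_of_gaussian (S : Data) (μ ν) {δ η : ℝ} (hδ : 0 < δ) (hη : 0 < η)
    (h₁ : Integrable fun t => Real.exp (2 * δ * ‖S.Γx μ t‖ ^ 2) * ‖S.W₁ (S.Γx μ t)‖ *
      ‖deriv (S.Γx μ) t‖)
    (h₂ : Integrable fun t => Real.exp ((1 / (4 * δ) + η) * ‖S.Γy ν t‖ ^ 2) *
      ‖S.W₂ (S.Γy ν t)‖ * ‖deriv (S.Γy ν) t‖) (i j : ℕ) :
    Integrable fun q : ℝ × ℝ =>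
      S.Γx μ q.1 ^ i * S.Γy ν q.2 ^ j * S.W₁ (S.Γx μ q.1) * S.W₂ (S.Γy ν q.2) *
        Complex.exp (S.Γx μ q.1 * S.Γy ν q.2) *
          (deriv (S.Γx μ) q.1 * deriv (S.Γy ν) q.2) := by
  obtain ⟨C₁, hC₁⟩ := (Subgaussian.eval (X ^ i)) δ hδ
  obtain ⟨C₂, hC₂⟩ := (Subgaussian.eval (X ^ j)) η hη
  simp only [eval_pow, eval_X] at hC₁ hC₂
  have hx := (S.admissible_x μ).contDiff
  have hy := (S.admissible_y ν).contDiff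
  have c1 := hx.continuous.comp (continuous_fst (X := ℝ) (Y := ℝ))
  have c2 := hy.continuous.comp (continuous_snd (X := ℝ) (Y := ℝ))
  have c3 := (S.continuous_W₁ μ).comp (continuous_fst (X := ℝ) (Y := ℝ))
  have c4 := (S.continuous_W₂ ν).comp (continuous_snd (X := ℝ) (Y := ℝ))
  have c5 := (hx.continuous_deriv le_rfl).comp (continuous_fst (X := ℝ) (Y := ℝ))
  have c6 := (hy.continuous_deriv le_rfl).comp (continuous_snd (X := ℝ) (Y := ℝ))
  have hcont := (((((c1.pow i).mul (c2.pow j)).mul c3).mul c4).mul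
    (Complex.continuous_exp.comp (c1.mul c2))).mul (c5.mul c6)
  refine ((h₁.mul_prod h₂).const_mul (C₁ * C₂)).mono' hcont.aestronglyMeasurable
    (Eventually.of_forall fun q => ?_)
  set ξ := S.Γx μ q.1
  set y := S.Γy ν q.2
  have hexp : ‖Complex.exp (ξ * y)‖ ≤
      Real.exp (δ * ‖ξ‖ ^ 2) * Real.exp (1 / (4 * δ) * ‖y‖ ^ 2) := by
    rw [Complex.norm_exp, ← Real.exp_add, Real.exp_le_exp]
    refine (Complex.re_le_norm _).trans ?_
    rw [norm_mul]
    have h : δ * ‖ξ‖ ^ 2 + 1 / (4 * δ) * ‖y‖ ^ 2 - ‖ξ‖ * ‖y‖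
        = (2 * δ * ‖ξ‖ - ‖y‖) ^ 2 / (4 * δ) := by
      field_simp
      ring
    have : 0 ≤ (2 * δ * ‖ξ‖ - ‖y‖) ^ 2 / (4 * δ) := by positivity
    linarith
  have hC₁0 := (norm_nonneg _).trans (hC₁ ξ)
  have hC₂0 := (norm_nonneg _).trans (hC₂ y)
  simp only [norm_mul]
  calc ‖ξ ^ i‖ * ‖y ^ j‖ * ‖S.W₁ ξ‖ * ‖S.W₂ y‖ * ‖Complex.exp (ξ * y)‖ *
        (‖deriv (S.Γx μ) q.1‖ * ‖deriv (S.Γy ν) q.2‖)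
      ≤ (C₁ * Real.exp (δ * ‖ξ‖ ^ 2)) * (C₂ * Real.exp (η * ‖y‖ ^ 2)) * ‖S.W₁ ξ‖ * ‖S.W₂ y‖ *
          (Real.exp (δ * ‖ξ‖ ^ 2) * Real.exp (1 / (4 * δ) * ‖y‖ ^ 2)) *
        (‖deriv (S.Γx μ) q.1‖ * ‖deriv (S.Γy ν) q.2‖) := by
        gcongr
        · exact hC₁ ξ
        · exact hC₂ y
    _ = _ := by
        rw [show 2 * δ * ‖ξ‖ ^ 2 = δ * ‖ξ‖ ^ 2 + δ * ‖ξ‖ ^ 2 by ring, add_mul (1 / (4 * δ)) η,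
          Real.exp_add, Real.exp_add]
        ring

theorem Data.integrable_moment (S : Data) {μ ν} (hκ : S.κ μ ν ≠ 0) (i j : ℕ) :
    Integrable fun q : ℝ × ℝ =>
      S.Γx μ q.1 ^ i * S.Γy ν q.2 ^ j * S.W₁ (S.Γx μ q.1) * S.W₂ (S.Γy ν q.2) *
        Complex.exp (S.Γx μ q.1 * S.Γy ν q.2) *
          (deriv (S.Γx μ) q.1 * deriv (S.Γy ν) q.2) := by
  obtain ⟨ε₁, hε₁, h₁⟩ :=
    (S.admissible_x μ).integrable_gaussian S.isWeight₁ S.B₁_ne_zero S.deg₁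
  obtain ⟨ε₂, hε₂, h₂⟩ :=
    (S.admissible_y ν).integrable_gaussian S.isWeight₂ S.B₂_ne_zero S.deg₂
  have hd₁ := S.deg₁
  have hd₂ := S.deg₂
  by_cases hA : S.B₂.natDegree + 2 ≤ S.A₂.natDegree
  · refine S.integrable_moment_of_gaussian μ ν (half_pos hε₁) one_pos
      (h₁ _ (Or.inl (by linarith))) (h₂ _ (Or.inr hA)) i j
  by_cases hA' : S.B₁.natDegree + 2 ≤ S.A₁.natDegree
  -- With this `δ` one has `1 / (4δ) = ε₂ / 2`, so together with `η = ε₂ / 2` the second variable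
  -- uses exactly `ε₂`. The first may use any Gaussian.
  · refine S.integrable_moment_of_gaussian μ ν (δ := 1 / (2 * ε₂)) (by positivity)
      (half_pos hε₂) (h₁ _ (Or.inr hA')) (h₂ _ (Or.inl (le_of_eq ?_))) i j
    field_simp
    ring
  exact S.converges (by omega) (by omega) μ ν hκ i j

/-! ### The bimoment functional with a multiplier -/

/-- The function `h` is continuous and bounded on the contours of the first variable. -/
def Data.IsMultiplier (S : Data) (h : ℂ → ℂ) : Prop :=
  ∀ μ, Continuous (fun t => h (S.Γx μ t)) ∧ ∃ C, ∀ t, ‖h (S.Γx μ t)‖ ≤ C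

theorem Data.isMultiplier_one (S : Data) : S.IsMultiplier fun _ => 1 := fun _ =>
  ⟨continuous_const, 1, fun _ => by simp⟩

theorem Data.OffContours.ne {S : Data} {z : ℂ} (hz : S.OffContours z) (μ t) :
    z - S.Γx μ t ≠ 0 := fun h =>
  hz μ (subset_closure ⟨t, (sub_eq_zero.1 h).symm⟩)

theorem Data.OffContours.isMultiplier {S : Data} {z : ℂ} (hz : S.OffContours z) :
    S.IsMultiplier fun ξ => 1 / (z - ξ) := fun μ => by
  refine ⟨continuous_const.div (continuous_const.sub (S.admissible_x μ).contDiff.continuous)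
    (hz.ne μ), ?_⟩
  have := hz μ
  rw [Metric.mem_closure_iff] at this
  push Not at this
  obtain ⟨ε, hε, h⟩ := this
  refine ⟨1 / ε, fun t => ?_⟩
  rw [norm_div, norm_one, ← dist_eq_norm]
  exact one_div_le_one_div_of_le hε (h _ ⟨t, rfl⟩)

theorem Data.IsMultiplier.dblIntegrable {S : Data} {h : ℂ → ℂ} (hh : S.IsMultiplier h)
    (P Q : ℂ[X]) : S.DblIntegrable fun ξ y =>
      h ξ * (P.eval ξ * Q.eval y * (S.W₁ ξ * S.W₂ y * Complex.exp (ξ * y))) := by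
  intro μ ν hκ
  obtain ⟨hc, C, hC⟩ := hh μ
  have h1 : Integrable fun q : ℝ × ℝ => ∑ i ∈ Finset.range (P.natDegree + 1),
      ∑ j ∈ Finset.range (Q.natDegree + 1), P.coeff i * Q.coeff j *
      (S.Γx μ q.1 ^ i * S.Γy ν q.2 ^ j * S.W₁ (S.Γx μ q.1) * S.W₂ (S.Γy ν q.2) *
        Complex.exp (S.Γx μ q.1 * S.Γy ν q.2) *
          (deriv (S.Γx μ) q.1 * deriv (S.Γy ν) q.2)) :=
    integrable_finsetSum _ fun i _ => integrable_finsetSum _ fun j _ =>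
      (S.integrable_moment hκ i j).const_mul _
  refine (h1.bdd_mul (f := fun q => h (S.Γx μ q.1)) (c := C)
    (hc.comp continuous_fst).aestronglyMeasurable (Eventually.of_forall fun q => hC q.1)).congr
    (Eventually.of_forall fun q => ?_)
  simp only
  rw [eval_eq_sum_range, eval_eq_sum_range, Finset.sum_mul_sum, mul_assoc, Finset.sum_mul,
    Finset.sum_mul]
  congr 1
  refine Finset.sum_congr rfl fun i _ => ?_
  rw [Finset.sum_mul, Finset.sum_mul]
  refine Finset.sum_congr rfl fun j _ => ?_
  ring

/-- The functional `(P, Q) ↦ ∬_κ h(ξ) P(ξ) Q(y) exp(-V₁(ξ) - V₂(y) + ξ y) dξ dy`. -/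
def Data.bimoment (S : Data) {h : ℂ → ℂ} (hh : S.IsMultiplier h) :
    ℂ[X] →ₗ[ℂ] ℂ[X] →ₗ[ℂ] ℂ :=
  LinearMap.mk₂ ℂ
    (fun P Q => S.dbl fun ξ y =>
      h ξ * (P.eval ξ * Q.eval y * (S.W₁ ξ * S.W₂ y * Complex.exp (ξ * y))))
    (fun P P' Q => by
      rw [← S.dbl_add (hh.dblIntegrable P Q) (hh.dblIntegrable P' Q)]
      congr 1
      funext ξ y
      rw [eval_add]
      ring)
    (fun c P Q => by
      rw [smul_eq_mul, ← S.dbl_const_mul]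
      congr 1
      funext ξ y
      rw [eval_smul, smul_eq_mul]
      ring)
    (fun P Q Q' => by
      rw [← S.dbl_add (hh.dblIntegrable P Q) (hh.dblIntegrable P Q')]
      congr 1
      funext ξ y
      rw [eval_add]
      ring)
    (fun c P Q => by
      rw [smul_eq_mul, ← S.dbl_const_mul]
      congr 1
      funext ξ y
      rw [eval_smul, smul_eq_mul]
      ring)

theorem Data.bimoment_apply (S : Data) {h : ℂ → ℂ} (hh : S.IsMultiplier h) (P Q : ℂ[X]) :
    S.bimoment hh P Q = S.dbl fun ξ y =>
      h ξ * (P.eval ξ * Q.eval y * (S.W₁ ξ * S.W₂ y * Complex.exp (ξ * y))) := rfl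

theorem Data.bimoment_one (S : Data) (P Q : ℂ[X]) :
    S.bimoment S.isMultiplier_one P Q = S.ℒ P Q := by
  simp only [Data.bimoment_apply, one_mul, Data.ℒ]

/-- Integration by parts in the second variable. -/
theorem Data.bimoment_X_mul (S : Data) {h : ℂ → ℂ} (hh : S.IsMultiplier h) (P T : ℂ[X]) :
    S.bimoment hh (X * P) (S.B₂ * T) = -S.bimoment hh P (S.B₂ * derivative T - S.A₂ * T) := by
  -- For fixed `ξ` the factors in `ξ` come out of the inner integral, where the one-variable
  -- integration by parts applies with parameter `ξ`.
  have key : ∀ (P Q : ℂ[X]) ν ξ, lineInt (S.Γy ν) (fun y =>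
      h ξ * (P.eval ξ * Q.eval y * (S.W₁ ξ * S.W₂ y * Complex.exp (ξ * y))))
      = h ξ * P.eval ξ * S.W₁ ξ *
        lineInt (S.Γy ν) (fun y => Complex.exp (ξ * y) * Q.eval y * S.W₂ y) := by
    intro P Q ν ξ
    rw [← lineInt_const_mul]
    exact lineInt_congr fun t => by ring
  simp only [Data.bimoment_apply, Data.dbl, key, ← Finset.sum_neg_distrib]
  refine Finset.sum_congr rfl fun μ _ => Finset.sum_congr rfl fun ν _ => ?_
  rw [← mul_neg]
  congr 1
  rw [neg_eq_neg_one_mul, ← lineInt_const_mul]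
  refine lineInt_congr fun t => ?_
  rw [(S.admissible_y ν).lineInt_exp_mul S.isWeight₂ S.B₂_ne_zero S.deg₂, eval_mul, eval_X]
  ring

/-- This is `ξ / (z - ξ) = z / (z - ξ) - 1`. The `-1` is the source of the inhomogeneous terms in
both parts of the theorem. -/
theorem Data.OffContours.bimoment_X_mul {S : Data} {z : ℂ} (hz : S.OffContours z) (P Q : ℂ[X]) :
    S.bimoment hz.isMultiplier (X * P) Q
      = z * S.bimoment hz.isMultiplier P Q - S.ℒ P Q := by
  rw [← S.bimoment_one, sub_eq_add_neg, neg_eq_neg_one_mul]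
  simp only [Data.bimoment_apply]
  rw [← S.dbl_const_mul, ← S.dbl_const_mul, ← S.dbl_add
    ((hz.isMultiplier.dblIntegrable P Q).const_mul z)
    ((S.isMultiplier_one.dblIntegrable P Q).const_mul (-1))]
  refine S.dbl_congr fun μ ν t t' => ?_
  have := hz.ne μ t
  simp only [eval_mul, eval_X]
  field_simp
  ring

/-! ### Biorthogonal polynomials -/

theorem exists_eq_sum_smul {b : ℕ → ℂ[X]} (hb : ∀ n, (b n).degree = n) (N : ℕ) :
    ∀ q : ℂ[X], q.degree < N → ∃ c : ℕ → ℂ, q = ∑ i ∈ Finset.range N, c i • b i := by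
  induction N with
  | zero =>
    intro q hq
    refine ⟨0, ?_⟩
    rw [Nat.cast_zero, Nat.WithBot.lt_zero_iff, degree_eq_bot] at hq
    simp [hq]
  | succ N ih =>
    intro q hq
    have hlc : (b N).coeff N ≠ 0 := coeff_ne_zero_of_eq_degree (hb N)
    have hq' : (q - (q.coeff N / (b N).coeff N) • b N).degree < N := by
      rw [degree_lt_iff_coeff_zero]
      intro m hm
      rcases hm.eq_or_lt with rfl | hm
      · simp [div_mul_cancel₀ _ hlc]
      · have h1 : q.coeff m = 0 := coeff_eq_zero_of_degree_lt (hq.trans_le (by exact_mod_cast hm))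
        have h2 : (b N).coeff m = 0 :=
          coeff_eq_zero_of_degree_lt (by rw [hb N]; exact_mod_cast hm)
        simp [h1, h2]
    obtain ⟨c, hc⟩ := ih _ hq'
    refine ⟨fun i => if i = N then q.coeff N / (b N).coeff N else c i, ?_⟩
    simp only [Finset.sum_range_succ, if_true]
    rw [← sub_eq_iff_eq_add, hc]
    refine Finset.sum_congr rfl fun i hi => ?_
    rw [if_neg (Finset.mem_range.1 hi).ne]

/-- Two sequences of polynomials, of degree `n` at the index `n`, dual with respect to `F`. -/
structure IsBiorthonormal (F : ℂ[X] →ₗ[ℂ] ℂ[X] →ₗ[ℂ] ℂ) (p s : ℕ → ℂ[X]) : Prop where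
  degree_left : ∀ n, (p n).degree = n
  degree_right : ∀ n, (s n).degree = n
  apply_eq : ∀ n m, F (p n) (s m) = if n = m then 1 else 0

namespace IsBiorthonormal

variable {F : ℂ[X] →ₗ[ℂ] ℂ[X] →ₗ[ℂ] ℂ} {p s : ℕ → ℂ[X]}

theorem eq_sum_right (h : IsBiorthonormal F p s) {N : ℕ} {q : ℂ[X]} (hq : q.degree < N) :
    q = ∑ i ∈ Finset.range N, F (p i) q • s i := by
  obtain ⟨c, hc⟩ := exists_eq_sum_smul h.degree_right N q hq
  conv_lhs => rw [hc]
  refine Finset.sum_congr rfl fun i hi => ?_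
  congr 1
  rw [hc, map_sum]
  simp only [map_smul, h.apply_eq, smul_eq_mul, mul_ite, mul_one, mul_zero, Finset.sum_ite_eq,
    if_pos hi]

theorem apply_eq_zero_of_degree_lt (h : IsBiorthonormal F p s) {n : ℕ} {q : ℂ[X]}
    (hq : q.degree < n) : F (p n) q = 0 := by
  rw [h.eq_sum_right hq, map_sum]
  refine Finset.sum_eq_zero fun i hi => ?_
  rw [map_smul, h.apply_eq, if_neg (Finset.mem_range.1 hi).ne', smul_zero]

end IsBiorthonormal

theorem IsNormalizedBOP.isBiorthonormal {F : ℂ[X] →ₗ[ℂ] ℂ[X] →ₗ[ℂ] ℂ} {p s : ℕ → ℂ[X]}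
    (h : IsNormalizedBOP (fun P Q => F P Q) p s) : IsBiorthonormal F p s := by
  obtain ⟨π, σ, r, hπ, hσ, hr, hF, hp, hs⟩ := h
  have hdeg : ∀ (π : ℂ[X]) (n : ℕ) (c : ℂ), c ≠ 0 → π.Monic → π.natDegree = n →
      (C c⁻¹ * π).degree = n := by
    intro π n c hc h1 h2
    rw [degree_C_mul (inv_ne_zero hc), degree_eq_natDegree h1.ne_zero, h2]
  refine ⟨fun n => ?_, fun n => ?_, fun n m => ?_⟩
  · rw [hp]
    exact hdeg _ _ _ (hr n) (hπ n).1 (hπ n).2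
  · rw [hs]
    exact hdeg _ _ _ (hr n) (hσ n).1 (hσ n).2
  · have : F (π n) (σ m) = if n = m then r n ^ 2 else 0 := hF n m
    rw [hp, hs, ← smul_eq_C_mul, ← smul_eq_C_mul, map_smul, map_smul, LinearMap.smul_apply, this]
    split_ifs with hnm
    · have := hr m
      subst hnm
      simp only [smul_eq_mul]
      field_simp
    · simp

/-! ### The dual polynomials of the associated functional -/

section Associated

variable {F : ℂ[X] →ₗ[ℂ] ℂ[X] →ₗ[ℂ] ℂ} {p : ℕ → ℂ[X]} {B : ℂ[X]} {n : ℕ}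

/-- The monomials of degree at most `n` are combinations of `p 0, …, p n`, so the coefficient vector
of `T` lies in the kernel of an invertible moment matrix. -/
theorem eq_zero_of_minor_ne_zero (hp : ∀ n, (p n).degree = n)
    (hdet : minor (fun P Q => F P (B * Q)) (n + 1) ≠ 0) {T : ℂ[X]}
    (hT : T.degree < ((n + 1 : ℕ) : WithBot ℕ)) (h : ∀ m, m ≤ n → F (p m) (B * T) = 0) :
    T = 0 := by
  have hX : ∀ i, i ≤ n → F (X ^ i) (B * T) = 0 := by
    intro i hi
    obtain ⟨c, hc⟩ := exists_eq_sum_smul hp (n + 1) (X ^ i)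
      (by rw [degree_X_pow]; exact_mod_cast Nat.lt_succ_of_le hi)
    rw [hc, map_sum, LinearMap.sum_apply]
    refine Finset.sum_eq_zero fun m hm => ?_
    rw [map_smul, LinearMap.smul_apply, h m (Nat.lt_succ_iff.1 (Finset.mem_range.1 hm)), smul_zero]
  have hTs : T = ∑ j : Fin (n + 1), T.coeff j • X ^ (j : ℕ) := by
    rw [Fin.sum_univ_eq_sum_range (fun j => T.coeff j • (X : ℂ[X]) ^ j)]
    conv_lhs => rw [T.as_sum_range' (n + 1) (by
      rcases eq_or_ne T 0 with rfl | h0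
      · simp
      · rwa [natDegree_lt_iff_degree_lt h0])]
    simp [smul_X_eq_monomial]
  have hv := Matrix.eq_zero_of_mulVec_eq_zero hdet (v := fun j => T.coeff j) (by
    funext i
    have h1 := hX i (Nat.lt_succ_iff.1 i.2)
    rw [hTs, Finset.mul_sum, map_sum] at h1
    simp only [mul_smul_comm, map_smul, smul_eq_mul] at h1
    simp only [Matrix.mulVec, dotProduct, Matrix.of_apply, Pi.zero_apply]
    rw [← h1]
    exact Finset.sum_congr rfl fun j _ => mul_comm _ _)
  rw [hTs]
  refine Finset.sum_eq_zero fun j _ => ?_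
  rw [show T.coeff j = 0 from congrFun hv j, zero_smul]

theorem exists_of_minor_ne_zero (hp : ∀ n, (p n).degree = n)
    (hdet : minor (fun P Q => F P (B * Q)) (n + 1) ≠ 0) :
    ∃ T : ℂ[X], T.degree < ((n + 1 : ℕ) : WithBot ℕ) ∧ (∀ m, m < n → F (p m) (B * T) = 0) ∧
      F (p n) (B * T) = 1 := by
  set M : Matrix (Fin (n + 1)) (Fin (n + 1)) ℂ :=
    Matrix.of fun i j => F (X ^ (i : ℕ)) (B * X ^ (j : ℕ)) with hM
  have hlc : (p n).coeff n ≠ 0 := coeff_ne_zero_of_eq_degree (hp n)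
  -- With this right side, `P ↦ F P (B * T)` on degree at most `n` extracts the coefficient of `X ^
  -- n` and divides it by that of `p n`. It therefore kills `p m` for `m < n` and equals `1` at `p
  -- n`.
  set v : Fin (n + 1) → ℂ := fun i => if (i : ℕ) = n then ((p n).coeff n)⁻¹ else 0 with hv
  set c := M⁻¹.mulVec v
  have hMc : M.mulVec c = v := by
    rw [Matrix.mulVec_mulVec, Matrix.mul_nonsing_inv _ (isUnit_iff_ne_zero.2 hdet),
      Matrix.one_mulVec]
  set T : ℂ[X] := ∑ j : Fin (n + 1), c j • X ^ (j : ℕ) with hT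
  have hX : ∀ i : Fin (n + 1), F (X ^ (i : ℕ)) (B * T) = v i := by
    intro i
    rw [← hMc, hT, Finset.mul_sum, map_sum]
    simp only [mul_smul_comm, map_smul, smul_eq_mul, Matrix.mulVec, dotProduct, hM,
      Matrix.of_apply]
    exact Finset.sum_congr rfl fun j _ => mul_comm _ _
  have hP : ∀ P : ℂ[X], P.natDegree < n + 1 →
      F P (B * T) = P.coeff n * ((p n).coeff n)⁻¹ := by
    intro P hPd
    conv_lhs => rw [P.as_sum_range' (n + 1) hPd]
    rw [map_sum, LinearMap.sum_apply, Finset.sum_eq_single n]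
    · have := hX (Fin.last n)
      rw [Fin.val_last] at this
      rw [← smul_X_eq_monomial, map_smul, LinearMap.smul_apply, this]
      simp [hv]
    · intro i hi hin
      rw [← smul_X_eq_monomial, map_smul, LinearMap.smul_apply, hX ⟨i, Finset.mem_range.1 hi⟩]
      simp [hv, hin]
    · simp
  refine ⟨T, ?_, fun m hm => ?_, ?_⟩
  · refine mem_degreeLT.1 (Submodule.sum_mem _ fun j _ => Submodule.smul_mem _ _ ?_)
    rw [mem_degreeLT, degree_X_pow]
    exact_mod_cast j.2
  · rw [hP _ (by rw [natDegree_eq_of_degree_eq_some (hp m)]; omega),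
      coeff_eq_zero_of_degree_lt (by rw [hp]; exact_mod_cast hm), zero_mul]
  · rw [hP _ (by rw [natDegree_eq_of_degree_eq_some (hp n)]; omega), mul_inv_cancel₀ hlc]

end Associated

/-! ### Existence and uniqueness of the recurrence matrices -/

section DiffRec

variable {S : Data} {p s : ℕ → ℂ[X]} {Lh Ah : ℕ → ℕ → ℂ}

/-- The bimoment functional as a bilinear map. -/
def Data.bilin (S : Data) : ℂ[X] →ₗ[ℂ] ℂ[X] →ₗ[ℂ] ℂ := S.bimoment S.isMultiplier_one

theorem Data.bilin_apply (S : Data) (P Q : ℂ[X]) : S.bilin P Q = S.ℒ P Q := S.bimoment_one P Q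

theorem Data.q_lt_d (S : Data) : S.q < S.d := S.deg₂

theorem degree_upperCombo_lt (hs : ∀ n, (s n).degree = n) (n : ℕ) :
    (S.upperCombo Lh s n).degree < ((n + S.q + 1 : ℕ) : WithBot ℕ) := by
  have h : ∀ m, m ≤ n + S.q → s m ∈ degreeLT ℂ (n + S.q + 1) := fun m hm => by
    rw [mem_degreeLT, hs]
    exact_mod_cast Nat.lt_succ_of_le hm
  refine mem_degreeLT.1 (add_mem (h n (by omega)) (Submodule.sum_mem _ fun j hj =>
    Submodule.smul_mem _ _ (h _ ?_)))
  have := Finset.mem_Icc.1 hj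
  omega

theorem degree_lt_of_B₂_mul {T : ℂ[X]} {n : ℕ}
    (h : (S.B₂ * T).degree < ((n + S.q + 1 : ℕ) : WithBot ℕ)) :
    T.degree < ((n + 1 : ℕ) : WithBot ℕ) := by
  rcases eq_or_ne T 0 with rfl | hT
  · simp
  rw [← natDegree_lt_iff_degree_lt (mul_ne_zero S.B₂_ne_zero hT),
    natDegree_mul S.B₂_ne_zero hT] at h
  rw [← natDegree_lt_iff_degree_lt hT]
  simp only [Data.q] at h
  omega

theorem degree_B₂_mul_lt {T : ℂ[X]} {n : ℕ} (h : T.degree < ((n + 1 : ℕ) : WithBot ℕ)) :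
    (S.B₂ * T).degree < ((n + S.q + 1 : ℕ) : WithBot ℕ) := by
  rcases eq_or_ne T 0 with rfl | hT
  · simp
  rw [← natDegree_lt_iff_degree_lt hT] at h
  rw [← natDegree_lt_iff_degree_lt (mul_ne_zero S.B₂_ne_zero hT), natDegree_mul S.B₂_ne_zero hT]
  simp only [Data.q]
  omega

theorem degree_B₂_mul_derivative_sub_lt {T : ℂ[X]} {n : ℕ}
    (h : T.degree < ((n + 1 : ℕ) : WithBot ℕ)) :
    (S.B₂ * derivative T - S.A₂ * T).degree < ((n + S.d + 1 : ℕ) : WithBot ℕ) := by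
  have hq : S.B₂.natDegree < S.d := S.q_lt_d
  have hT : T.natDegree < n + 1 := by
    rcases eq_or_ne T 0 with rfl | hT
    · simp
    · rwa [natDegree_lt_iff_degree_lt hT]
  have h1 : (S.B₂ * derivative T - S.A₂ * T).natDegree < n + S.d + 1 := by
    refine Nat.lt_succ_of_le ((natDegree_sub_le _ _).trans (max_le ?_ ?_))
    · refine natDegree_mul_le.trans ?_
      have := natDegree_derivative_le T
      omega
    · refine natDegree_mul_le.trans ?_
      simp only [Data.d]
      omega
  exact degree_le_natDegree.trans_lt (by exact_mod_cast h1)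

theorem upperCombo_eq {E : Type*} [AddCommGroup E] [Module ℂ E]
    (hL : ∀ i n, Lh i n ≠ 0 → n < i ∧ i ≤ n + S.q) (f : ℕ → E) {n N : ℕ} (hN : n + S.q < N) :
    S.upperCombo Lh f n = f n + ∑ i ∈ Finset.range N, Lh i n • f i := by
  rw [Data.upperCombo]
  congr 1
  refine Finset.sum_bij_ne_zero (fun j _ _ => n + j) ?_ ?_ ?_ ?_
  · intro j hj _
    have := Finset.mem_Icc.1 hj
    exact Finset.mem_range.2 (by omega)
  · intro j _ _ j' _ _ hjj
    omega
  · intro i _ hi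
    have hLi : Lh i n ≠ 0 := fun h0 => hi (by rw [h0, zero_smul])
    have := hL i n hLi
    have he : n + (i - n) = i := by omega
    exact ⟨i - n, Finset.mem_Icc.2 (by omega), by rwa [he], he⟩
  · intro j _ _
    rfl

theorem Data.IsDiffRec.bilin_upperCombo (h : S.IsDiffRec s Lh Ah)
    (hb : IsBiorthonormal S.bilin p s) (m n : ℕ) :
    S.bilin (p m) (S.upperCombo Lh s n) = (if m = n then 1 else 0) + Lh m n := by
  simp only [Data.upperCombo, map_add, map_sum, map_smul, hb.apply_eq, smul_eq_mul, mul_ite,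
    mul_one, mul_zero]
  congr 1
  by_cases hL : Lh m n = 0
  · rw [hL]
    refine Finset.sum_eq_zero fun j _ => ?_
    split_ifs with hj
    · rw [← hj, hL]
    · rfl
  · have := h.band_L m n hL
    rw [Finset.sum_eq_single (m - n), if_pos (by omega)]
    · congr 1
      omega
    · intro j _ hj
      rw [if_neg (by omega)]
    · intro hm
      exact absurd (Finset.mem_Icc.2 (by omega)) hm

/-- For `f = B₂ T` the expression `B₂ f' - (A₂ + B₂') f` equals `B₂ (B₂ T' - A₂ T)`, and the outer
`B₂` cancels. -/
theorem Data.IsDiffRec.exists_factor (h : S.IsDiffRec s Lh Ah) (hs : ∀ n, (s n).degree = n)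
    {n N : ℕ} (hN : n + S.d < N) :
    ∃ T : ℂ[X], S.upperCombo Lh s n = S.B₂ * T ∧ T.degree < ((n + 1 : ℕ) : WithBot ℕ) ∧
      S.B₂ * derivative T - S.A₂ * T = -∑ i ∈ Finset.range N, Ah i n • s i := by
  obtain ⟨T, hT⟩ := h.dvd n
  refine ⟨T, hT, degree_lt_of_B₂_mul (hT ▸ degree_upperCombo_lt hs n), ?_⟩
  have := h.diff_eq n
  rw [hT] at this
  rw [← Finset.sum_subset (Finset.range_mono (Nat.succ_le_of_lt hN))]
  · refine mul_left_cancel₀ S.B₂_ne_zero ?_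
    rw [derivative_mul] at this
    linear_combination this
  · intro i _ hi
    by_cases hA : Ah i n = 0
    · rw [hA, zero_smul]
    · have := (h.band_A i n hA).2
      exact absurd (Finset.mem_range.2 (by omega)) hi

theorem Data.bilin_X_mul (S : Data) (P T : ℂ[X]) :
    S.bilin (X * P) (S.B₂ * T) = -S.bilin P (S.B₂ * derivative T - S.A₂ * T) :=
  S.bimoment_X_mul S.isMultiplier_one P T

/-- Integration by parts carries `x` over to the second variable, where `Ahat` is defined. The same
matrix thus governs multiplication by `x` in the first variable. -/
theorem Data.IsDiffRec.bilin_X_mul (h : S.IsDiffRec s Lh Ah)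
    (hb : IsBiorthonormal S.bilin p s) (i n : ℕ) :
    S.bilin (X * p i) (S.upperCombo Lh s n) = Ah i n := by
  obtain ⟨T, hT, -, hA⟩ := h.exists_factor hb.degree_right (Nat.lt_succ_self (n + S.d))
  rw [hT, S.bilin_X_mul, hA, map_neg, neg_neg, map_sum]
  simp only [map_smul, hb.apply_eq, smul_eq_mul, mul_ite, mul_one, mul_zero, Finset.sum_ite_eq]
  split_ifs with hi
  · rfl
  · by_contra hne
    have := h.band_A i n (Ne.symm hne)
    rw [Finset.mem_range] at hi
    omega

/-- The difference of two candidate quotients by `B₂` has degree at most `n` and pairs to zero with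
`p 0, …, p n`, so it vanishes. Both matrices are then recovered as pairings. -/
theorem Data.IsDiffRec.unique {Lh' Ah' : ℕ → ℕ → ℂ} (h : S.IsDiffRec s Lh Ah)
    (h' : S.IsDiffRec s Lh' Ah') (hb : IsBiorthonormal S.bilin p s)
    (hgen : ∀ n : ℕ, minor S.ℒhat n ≠ 0) : Lh = Lh' ∧ Ah = Ah' := by
  have hdet : ∀ n, minor (fun P Q => S.bilin P (S.B₂ * Q)) n ≠ 0 := by
    simp only [S.bilin_apply]
    exact hgen
  have hlow : ∀ {Lh Ah : ℕ → ℕ → ℂ}, S.IsDiffRec s Lh Ah → ∀ {m n : ℕ}, m ≤ n → Lh m n = 0 := by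
    intro Lh Ah h m n hmn
    by_contra hne
    have := h.band_L m n hne
    omega
  have heq : ∀ n, S.upperCombo Lh s n = S.upperCombo Lh' s n := by
    intro n
    obtain ⟨T, hT, hTd, -⟩ := h.exists_factor hb.degree_right (Nat.lt_succ_self (n + S.d))
    obtain ⟨T', hT', hTd', -⟩ := h'.exists_factor hb.degree_right (Nat.lt_succ_self (n + S.d))
    have h0 : T - T' = 0 := by
      refine eq_zero_of_minor_ne_zero hb.degree_left (hdet (n + 1))
        ((degree_sub_le _ _).trans_lt (max_lt hTd hTd')) fun m hm => ?_
      rw [mul_sub, ← hT, ← hT', map_sub, h.bilin_upperCombo hb, h'.bilin_upperCombo hb,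
        hlow h hm, hlow h' hm, sub_self]
    rw [hT, hT', sub_eq_zero.1 h0]
  constructor
  · funext m n
    have h1 := h.bilin_upperCombo hb m n
    have h2 := h'.bilin_upperCombo hb m n
    rw [heq, h2] at h1
    exact (add_left_cancel h1).symm
  · funext m n
    rw [← h.bilin_X_mul hb, ← h'.bilin_X_mul hb, heq]

theorem Data.exists_isDiffRec (hb : IsBiorthonormal S.bilin p s)
    (hgen : ∀ n : ℕ, minor S.ℒhat n ≠ 0) : ∃ Lh Ah : ℕ → ℕ → ℂ, S.IsDiffRec s Lh Ah := by
  have hdet : ∀ n, minor (fun P Q => S.bilin P (S.B₂ * Q)) n ≠ 0 := by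
    simp only [S.bilin_apply]
    exact hgen
  choose T hTd hT0 hT1 using fun n =>
    exists_of_minor_ne_zero (n := n) hb.degree_left (hdet (n + 1))
  set Lh : ℕ → ℕ → ℂ := fun i n =>
    if n < i ∧ i ≤ n + S.q then S.bilin (p i) (S.B₂ * T n) else 0 with hLh
  set Ah : ℕ → ℕ → ℂ := fun i n => S.bilin (X * p i) (S.B₂ * T n) with hAh
  have hband : ∀ i n, Lh i n ≠ 0 → n < i ∧ i ≤ n + S.q := fun i n hne => by
    by_contra hcon
    exact hne (if_neg hcon)
  -- In the basis `s`, the coefficients of `B₂ T n` are `0` below index `n`, `1` at `n`, and `Lh`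
  -- from `n + 1` to `n + q`, the maximal degree.
  have hcombo : ∀ n, S.upperCombo Lh s n = S.B₂ * T n := by
    intro n
    conv_rhs => rw [hb.eq_sum_right (degree_B₂_mul_lt (hTd n))]
    rw [upperCombo_eq hband s (N := n + S.q + 1) (by omega),
      show s n = ∑ i ∈ Finset.range (n + S.q + 1), (if n = i then (1 : ℂ) else 0) • s i by
        simp only [ite_smul, one_smul, zero_smul, Finset.sum_ite_eq, Finset.mem_range]
        rw [if_pos (by omega)],
      ← Finset.sum_add_distrib]
    refine Finset.sum_congr rfl fun i hi => ?_
    rw [← add_smul]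
    congr 1
    have hi' := Finset.mem_range.1 hi
    rcases lt_trichotomy i n with h | rfl | h
    · simp [hLh, hT0 n i h, h.ne', h.not_gt]
    · simp [hLh, hT1]
    · simp only [hLh]
      rw [if_neg h.ne, if_pos ⟨h, by omega⟩, zero_add]
  have hdiff : ∀ n, S.B₂ * derivative (T n) - S.A₂ * T n
      = -∑ i ∈ Finset.range (n + S.d + 1), Ah i n • s i := by
    intro n
    conv_lhs => rw [hb.eq_sum_right (degree_B₂_mul_derivative_sub_lt (hTd n))]
    rw [← Finset.sum_neg_distrib]
    refine Finset.sum_congr rfl fun i _ => ?_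
    rw [hAh, ← neg_smul]
    simp only [S.bilin_X_mul, neg_neg]
  refine ⟨Lh, Ah, ⟨hband, fun i n hne => ?_, fun n => ⟨T n, hcombo n⟩, fun n => ?_⟩⟩
  -- Above the superdiagonal, `X p i` has degree below `n` and `T n` annihilates it. Beyond `d`
  -- subdiagonals, `B₂ T' - A₂ T` has degree below `i`.
  · constructor
    · by_contra! hcon
      refine hne ?_
      obtain ⟨c, hc⟩ := exists_eq_sum_smul hb.degree_left n (X * p i) (by
        rw [degree_mul, degree_X, hb.degree_left]
        have : 1 + i < n := by omega
        exact_mod_cast this)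
      simp only [hAh]
      rw [hc, map_sum, LinearMap.sum_apply]
      refine Finset.sum_eq_zero fun m hm => ?_
      rw [map_smul, LinearMap.smul_apply, hT0 n m (Finset.mem_range.1 hm), smul_zero]
    · by_contra! hcon
      refine hne ?_
      simp only [hAh]
      rw [S.bilin_X_mul, hb.apply_eq_zero_of_degree_lt
        ((degree_B₂_mul_derivative_sub_lt (hTd n)).trans_le (by exact_mod_cast hcon)), neg_zero]
  · rw [hcombo, derivative_mul]
    linear_combination S.B₂ * hdiff n

/-! ### The associated polynomials in the first variable -/

theorem hatPoly_eq (Lh : ℕ → ℕ → ℂ) (p : ℕ → ℂ[X]) (n : ℕ) :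
    hatPoly Lh p n = p n - ∑ m ∈ Finset.range n, Lh n m • hatPoly Lh p m := by
  rw [hatPoly, ← Fin.sum_univ_eq_sum_range (fun m => Lh n m • hatPoly Lh p m)]

theorem degree_hatPoly (Lh : ℕ → ℕ → ℂ) (hp : ∀ n, (p n).degree = n) (n : ℕ) :
    (hatPoly Lh p n).degree = n := by
  induction n using Nat.strong_induction_on with
  | _ n ih =>
    rw [hatPoly_eq, degree_sub_eq_left_of_degree_lt, hp]
    rw [hp, ← mem_degreeLT]
    refine Submodule.sum_mem _ fun m hm => Submodule.smul_mem _ _ ?_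
    rw [mem_degreeLT, ih m (Finset.mem_range.1 hm)]
    exact_mod_cast Finset.mem_range.1 hm

/-- Pairing `p` with `(1 + Lhatᵗ) s` gives the matrix `1 + Lhat`, which the forward substitution
defining `hatPoly` inverts. -/
theorem Data.IsDiffRec.bilin_hatPoly_upperCombo (h : S.IsDiffRec s Lh Ah)
    (hb : IsBiorthonormal S.bilin p s) (m n : ℕ) :
    S.bilin (hatPoly Lh p m) (S.upperCombo Lh s n) = if m = n then 1 else 0 := by
  induction m using Nat.strong_induction_on with
  | _ m ih =>
    rw [hatPoly_eq, map_sub, LinearMap.sub_apply, h.bilin_upperCombo hb, map_sum,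
      LinearMap.sum_apply, Finset.sum_congr rfl fun k hk => by
        rw [map_smul, LinearMap.smul_apply, ih k (Finset.mem_range.1 hk)]]
    simp only [smul_eq_mul, mul_ite, mul_one, mul_zero, Finset.sum_ite_eq', Finset.mem_range]
    split_ifs with h1 h2 h2
    · omega
    · by_cases hL : Lh m n = 0
      · simp [hL]
      · have := h.band_L m n hL
        omega
    · simp
    · by_cases hL : Lh m n = 0
      · simp [hL]
      · have := h.band_L m n hL
        omega

theorem Data.IsDiffRec.eq_sum_hatPoly (h : S.IsDiffRec s Lh Ah)
    (hb : IsBiorthonormal S.bilin p s) {N : ℕ} {P : ℂ[X]} (hP : P.degree < N) :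
    P = ∑ m ∈ Finset.range N, S.bilin P (S.upperCombo Lh s m) • hatPoly Lh p m := by
  obtain ⟨c, hc⟩ := exists_eq_sum_smul (degree_hatPoly Lh hb.degree_left) N P hP
  conv_lhs => rw [hc]
  refine Finset.sum_congr rfl fun n hn => ?_
  rw [hc, map_sum, LinearMap.sum_apply]
  simp only [map_smul, LinearMap.smul_apply, h.bilin_hatPoly_upperCombo hb, smul_eq_mul, mul_ite,
    mul_one, mul_zero, Finset.sum_ite_eq', if_pos hn]

theorem Data.IsDiffRec.X_mul_eq_sum (h : S.IsDiffRec s Lh Ah)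
    (hb : IsBiorthonormal S.bilin p s) {i N : ℕ} (hN : i + 2 ≤ N) :
    X * p i = ∑ m ∈ Finset.range N, Ah i m • hatPoly Lh p m := by
  simp only [← h.bilin_X_mul hb]
  refine h.eq_sum_hatPoly hb ?_
  rw [degree_mul, degree_X, hb.degree_left]
  have : 1 + i < N := by omega
  exact_mod_cast this

theorem Data.IsDiffRec.eq_add_sum (h : S.IsDiffRec s Lh Ah) {r N : ℕ} (hN : r ≤ N) :
    p r = hatPoly Lh p r + ∑ m ∈ Finset.range N, Lh r m • hatPoly Lh p m := by
  rw [hatPoly_eq, ← Finset.sum_subset (Finset.range_mono hN), sub_add_cancel]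
  intro m _ hm
  by_cases hL : Lh r m = 0
  · rw [hL, zero_smul]
  · exact absurd (Finset.mem_range.2 (h.band_L r m hL).1) hm

end DiffRec

/-! ### The Christoffel–Darboux identities for banded matrices -/

section Banded

variable {d n : ℕ} {Lh Ah : ℕ → ℕ → ℂ}

/-- The commutator with `Π_n` is supported in the block cut out by the windows, so the finite block
can be replaced by `uᵗ M Π_n v - uᵗ Π_n M v`. All indices involved lie below `n + d`. -/
theorem cdPair_eq (hn : 1 ≤ n) (hd : 1 ≤ d) (hL : ∀ i j, Lh i j ≠ 0 → j < i ∧ i ≤ j + d)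
    (hA : ∀ i j, Ah i j ≠ 0 → j ≤ i + 1 ∧ i ≤ j + d) (w : ℂ) (u v : ℕ → ℂ) :
    cdPair d n Lh Ah w u v =
      ∑ j ∈ Finset.range n, (∑ i ∈ Finset.range (n + d), Ah i j * u i
        - w * ∑ i ∈ Finset.range (n + d), Lh i j * u i) * v j
      - ∑ i ∈ Finset.range n, u i * (∑ j ∈ Finset.range (n + d), Ah i j * v j
        - w * ∑ j ∈ Finset.range (n + d), Lh i j * v j) := by
  set M : ℕ → ℕ → ℂ := fun i j => Ah i j - w * Lh i j with hM
  have hband : ∀ i j, M i j ≠ 0 → j ≤ i + 1 ∧ i ≤ j + d := by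
    intro i j hne
    by_cases h1 : Ah i j = 0
    · by_cases h2 : Lh i j = 0
      · simp [hM, h1, h2] at hne
      · have := hL i j h2
        omega
    · exact hA i j h1
  -- An entry survives only if exactly one of `i`, `j` is below `n`; the band condition then
  -- confines both to the windows.
  have hcomm : ∀ i j, commEntry M n i j ≠ 0 → n - 1 ≤ i ∧ i < n + d ∧ n ≤ j + d ∧ j ≤ n := by
    intro i j hne
    have h1 : M i j ≠ 0 := fun h0 => hne (by simp [commEntry, h0])
    have h2 := hband i j h1
    by_cases hi : i < n <;> by_cases hj : j < n
    · simp [commEntry, hi, hj] at hne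
    · omega
    · omega
    · simp [commEntry, hi, hj] at hne
  have hrow : ∀ i, ∑ b : Fin (d + 1), (if d ≤ n + b then commEntry M n i (n + b - d) else 0) *
      window d n v b = ∑ j ∈ Finset.range (n + d), commEntry M n i j * v j := by
    intro i
    refine Finset.sum_bij_ne_zero (fun b _ _ => n + b - d) ?_ ?_ ?_ ?_
    · intro b _ _
      exact Finset.mem_range.2 (by omega)
    · intro b _ hb b' _ hb' hbb
      have h1 : d ≤ n + b := by
        by_contra hc
        simp [hc] at hb
      have h2 : d ≤ n + b' := by
        by_contra hc
        simp [hc] at hb'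
      exact Fin.ext (by omega)
    · intro j _ hj
      have := hcomm i j (left_ne_zero_of_mul hj)
      have he : n + (j + d - n) - d = j := by omega
      refine ⟨⟨j + d - n, by omega⟩, Finset.mem_univ _, ?_, he⟩
      simp only [window]
      rw [he, if_pos (by omega), if_pos (by omega)]
      exact hj
    · intro b _ hb
      have h1 : d ≤ n + b := by
        by_contra hc
        simp [hc] at hb
      simp [window, h1]
  have hsum : cdPair d n Lh Ah w u v =
      ∑ i ∈ Finset.range (n + d), u i * ∑ j ∈ Finset.range (n + d), commEntry M n i j * v j := by
    simp only [cdPair, dotProduct, Matrix.mulVec, cdMatrix, Matrix.of_apply, dualWindow]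
    simp only [← hM, hrow]
    refine Finset.sum_bij_ne_zero (fun a _ _ => n + a - 1) ?_ ?_ ?_ ?_
    · intro a _ _
      exact Finset.mem_range.2 (by omega)
    · intro a _ _ a' _ _ haa
      exact Fin.ext (by omega)
    · intro i hi hne
      obtain ⟨j, _, hj⟩ := Finset.exists_ne_zero_of_sum_ne_zero (right_ne_zero_of_mul hne)
      have := hcomm i j (left_ne_zero_of_mul hj)
      have he : n + (i + 1 - n) - 1 = i := by omega
      exact ⟨⟨i + 1 - n, by omega⟩, Finset.mem_univ _, by rwa [he], he⟩
    · intro a _ _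
      rfl
  have hfilter : Finset.range n = (Finset.range (n + d)).filter (· < n) := by
    ext j
    simp only [Finset.mem_filter, Finset.mem_range]
    omega
  have hcol : ∀ j, ∑ i ∈ Finset.range (n + d), Ah i j * u i
      - w * ∑ i ∈ Finset.range (n + d), Lh i j * u i
      = ∑ i ∈ Finset.range (n + d), M i j * u i := by
    intro j
    simp only [hM, Finset.mul_sum, ← Finset.sum_sub_distrib]
    exact Finset.sum_congr rfl fun i _ => by ring
  have hrow' : ∀ i, ∑ j ∈ Finset.range (n + d), Ah i j * v j
      - w * ∑ j ∈ Finset.range (n + d), Lh i j * v j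
      = ∑ j ∈ Finset.range (n + d), M i j * v j := by
    intro i
    simp only [hM, Finset.mul_sum, ← Finset.sum_sub_distrib]
    exact Finset.sum_congr rfl fun j _ => by ring
  simp only [hsum, hcol, hrow']
  rw [hfilter, Finset.sum_filter, Finset.sum_filter]
  simp only [commEntry, sub_mul, Finset.sum_sub_distrib, mul_sub]
  congr 1
  · simp only [Finset.mul_sum]
    rw [Finset.sum_comm]
    refine Finset.sum_congr rfl fun j _ => ?_
    split_ifs
    · rw [Finset.sum_mul]
      exact Finset.sum_congr rfl fun i _ => by ring
    · simp
  · refine Finset.sum_congr rfl fun i _ => ?_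
    split_ifs
    · simp
    · simp

/-- The Christoffel–Darboux identities for two sequences `u`, `w` satisfying recurrence relations
with banded matrices and inhomogeneous terms `e`, `c`. -/
theorem christoffelDarboux (hn : 1 ≤ n) (hd : 1 ≤ d)
    (hL : ∀ i j, Lh i j ≠ 0 → j < i ∧ i ≤ j + d)
    (hA : ∀ i j, Ah i j ≠ 0 → j ≤ i + 1 ∧ i ≤ j + d) {z x : ℂ} {u uhat v w e c : ℕ → ℂ}
    (huhat : ∀ m < n, uhat m = u m + ∑ i ∈ Finset.range (n + d), Lh i m * u i)
    (hu : ∀ m < n, z * uhat m = ∑ i ∈ Finset.range (n + d), Ah i m * u i + e m)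
    (hw : ∀ r < n, w r = v r + ∑ m ∈ Finset.range (n + d), Lh r m * v m)
    (hx : ∀ r < n, x * w r = ∑ m ∈ Finset.range (n + d), Ah r m * v m + c r) :
    (z - x) * truncPair n u w = cdPair d n Lh Ah z u v
        + (∑ r ∈ Finset.range n, e r * v r - ∑ r ∈ Finset.range n, u r * c r) ∧
      (z - x) * truncPair n uhat v = cdPair d n Lh Ah x u v
        + (∑ r ∈ Finset.range n, e r * v r - ∑ r ∈ Finset.range n, u r * c r) := by
  -- The identities hold term by term in `r`: the hypotheses express `Ahᵗ u`, `Lhᵗ u`, `Ah v`, `Lh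
  -- v` through `uhat`, `u`, `w`, `v`. At `z` the terms in `uhat` cancel, and at `x` those in `w`
  -- do.
  constructor <;>
  · rw [cdPair_eq hn hd hL hA, truncPair, Finset.mul_sum]
    simp only [← Finset.sum_sub_distrib, ← Finset.sum_add_distrib]
    refine Finset.sum_congr rfl fun r hr => ?_
    have hr' := Finset.mem_range.1 hr
    have h1 := huhat r hr'
    have h2 := hu r hr'
    have h3 := hw r hr'
    have h4 := hx r hr'
    grind

end Banded

/-! ### The bilinear concomitant -/

/-- The divided difference `(P(y) - P(s)) / (y - s)` of a polynomial in `y` whose coefficients are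
polynomials in `s`. -/
def dividedDiff (P : ℂ[X][X]) : ℂ[X][X] := (P - C (P.eval X)) /ₘ (X - C X)

theorem X_sub_C_mul_dividedDiff (P : ℂ[X][X]) :
    (X - C X) * dividedDiff P = P - C (P.eval X) :=
  mul_divByMonic_eq_iff_isRoot.2 (by simp)

theorem natDegree_dividedDiff_le (P : ℂ[X][X]) :
    (dividedDiff P).natDegree ≤ P.natDegree - 1 := by
  rw [dividedDiff, natDegree_divByMonic _ (monic_X_sub_C _), natDegree_sub_C, natDegree_X_sub_C]

theorem X_sub_C_mul_map_dividedDiff (P : ℂ[X][X]) (s : ℂ) :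
    (X - C s) * (dividedDiff P).map (evalRingHom s) = P.map (evalRingHom s)
      - C ((P.map (evalRingHom s)).eval s) := by
  have h := congrArg (Polynomial.map (evalRingHom s)) (X_sub_C_mul_dividedDiff P)
  rw [Polynomial.map_mul, Polynomial.map_sub, Polynomial.map_sub, map_X, map_C, map_C,
    coe_evalRingHom, eval_X] at h
  rw [h]
  congr 2
  have h2 := congrArg (eval s) h
  simp only [eval_mul, eval_sub, eval_X, eval_C, sub_self, zero_mul] at h2
  exact (sub_eq_zero.1 h2.symm).symm

theorem map_C_map_evalRingHom (P : ℂ[X]) (s : ℂ) : (P.map C).map (evalRingHom s) = P := by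
  have h : (evalRingHom s).comp C = RingHom.id ℂ := RingHom.ext fun y => by simp
  rw [Polynomial.map_map, h, Polynomial.map_id]

/-- In terms of the divided differences `a`, `b` of `A`, `B` at `s` and the divided difference `b'`
of `b`, the kernel is visibly polynomial, diagonal included. -/
theorem concomitant_eq {A B a b b' : ℂ[X]} {s : ℂ} (ha : (X - C s) * a = A - C (A.eval s))
    (hb : (X - C s) * b = B - C (B.eval s)) (hb' : (X - C s) * b' = b - C (b.eval s)) (x y : ℂ) :
    concomitant A B x y s = x * b.eval y - b'.eval y - a.eval y := by
  have hdiag : ∀ {P p : ℂ[X]}, (X - C s) * p = P - C (P.eval s) →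
      p.eval s = (derivative P).eval s := by
    intro P p h
    have := congrArg (fun q => (derivative q).eval s) h
    simpa using this
  rw [concomitant]
  split_ifs with hy
  -- Differentiating `(X - s) b = B - B(s)` twice at `s` shows that `b'(s)`, the derivative of `b`
  -- there, is `B''(s) / 2`.
  · have h2 := congrArg (fun q => (derivative (derivative q)).eval s) hb
    have h3 := hdiag hb'
    simp only [derivative_mul, derivative_sub, derivative_X, derivative_C, sub_zero,
      one_mul, derivative_add, eval_add, eval_mul, eval_sub, eval_X, eval_C, sub_self,
      zero_mul, add_zero] at h2
    rw [hy, hdiag ha, hdiag hb, h3]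
    linear_combination h2 / 2
  · have hne : y - s ≠ 0 := sub_ne_zero.2 hy
    have e1 := congrArg (eval y) ha
    have e2 := congrArg (eval y) hb
    have e3 := congrArg (eval y) hb'
    simp only [eval_mul, eval_sub, eval_X, eval_C] at e1 e2 e3
    rw [hdiag hb] at e3
    rw [← e2]
    field_simp
    linear_combination e1 + e3

/-- Divided differences lower the degree in `y` by one and `deg B < deg A`, whence the bound.
Working over polynomials in `s` keeps the coefficients polynomial. -/
theorem exists_concomitant_eq_sum {A B : ℂ[X]} (hdeg : B.natDegree + 1 ≤ A.natDegree) (x : ℂ) :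
    ∃ c : ℕ → ℂ[X], ∀ y s, concomitant A B x y s =
      ∑ a ∈ Finset.range A.natDegree, (c a).eval s * y ^ a := by
  set b := dividedDiff (B.map C) with hb
  set R : ℂ[X][X] := C (C x) * b - dividedDiff b - dividedDiff (A.map C) with hR
  have hRd : R.natDegree < A.natDegree := by
    have h1 : b.natDegree ≤ B.natDegree - 1 := by
      simpa using natDegree_dividedDiff_le (B.map C)
    have h2 := natDegree_dividedDiff_le b
    have h3 : (dividedDiff (A.map C)).natDegree ≤ A.natDegree - 1 := by
      simpa using natDegree_dividedDiff_le (A.map C)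
    have h4 := natDegree_C_mul_le (C x) b
    have h5 : R.natDegree ≤ max (C (C x) * b - dividedDiff b).natDegree
        (dividedDiff (A.map C)).natDegree := natDegree_sub_le _ _
    have h6 := natDegree_sub_le (C (C x) * b) (dividedDiff b)
    omega
  refine ⟨R.coeff, fun y s => ?_⟩
  have h1 := X_sub_C_mul_map_dividedDiff (A.map C) s
  have h2 := X_sub_C_mul_map_dividedDiff (B.map C) s
  rw [map_C_map_evalRingHom] at h1 h2
  rw [concomitant_eq h1 h2 (X_sub_C_mul_map_dividedDiff b s)]
  have h3 : (R.map (evalRingHom s)).eval y =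
      ∑ a ∈ Finset.range A.natDegree, (R.coeff a).eval s * y ^ a := by
    rw [eval_eq_sum_range' (natDegree_map_le.trans_lt hRd)]
    simp
  rw [← h3, hR]
  simp [hb]

/-! ### The wave vectors as linear functionals of polynomials -/

theorem lineInt_sum_mul {ι : Type*} (γ : ℝ → ℂ) (t : Finset ι) {f : ι → ℂ → ℂ} (K : ι → ℂ)
    (hf : ∀ a ∈ t, Integrable fun τ => f a (γ τ) * deriv γ τ) :
    lineInt γ (fun y => ∑ a ∈ t, f a y * K a) = ∑ a ∈ t, lineInt γ (f a) * K a := by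
  simp only [lineInt, ← integral_mul_const]
  rw [← integral_finsetSum _ fun a ha => (hf a ha).mul_const (K a)]
  simp only [Finset.sum_mul]
  congr 1
  funext τ
  exact Finset.sum_congr rfl fun a _ => by ring

theorem Data.integrable_d (S : Data) (k : Fin S.d) (x : ℂ) (P : ℂ[X]) :
    Integrable fun t => P.eval (S.Γd k t) * Complex.exp (x * S.Γd k t) * S.Wd (S.Γd k t) *
      deriv (S.Γd k) t := by
  have hdeg : S.B₂.natDegree + 1 ≤ (dualPoly S.A₂ S.B₂).natDegree := by
    rw [dualPoly, natDegree_neg, natDegree_add_derivative S.deg₂]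
    exact S.deg₂
  exact (S.admissible_d k).integrable (f := fun y => P.eval y * Complex.exp (x * y)) S.isWeightd
    S.B₂_ne_zero hdeg (P.continuous.mul (by fun_prop))
    ((Subgaussian.eval P).mul (Subgaussian.exp_mul x))

theorem Data.integrable_y (S : Data) (j : Fin S.d) (z : ℂ) (P : ℂ[X]) :
    Integrable fun t => Complex.exp (z * S.Γy j t) * (P.eval (S.Γy j t) * S.W₂ (S.Γy j t)) *
      deriv (S.Γy j) t := by
  simp only [← mul_assoc]
  exact (S.admissible_y j).integrable (f := fun y => Complex.exp (z * y) * P.eval y) S.isWeight₂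
    S.B₂_ne_zero S.deg₂ ((by fun_prop : Continuous fun y => Complex.exp (z * y)).mul P.continuous)
    ((Subgaussian.exp_mul z).mul (Subgaussian.eval P))

/-- The functional `Q ↦ ∫ exp(z y) Q(y) exp(-V₂(y)) dy` along the contour `Γy j`. -/
def Data.laplace (S : Data) (j : Fin S.d) (z : ℂ) : ℂ[X] →ₗ[ℂ] ℂ where
  toFun Q := S.dual j (fun y => Q.eval y * S.W₂ y) z
  map_add' P Q := by
    simp only [Data.dual, lineInt]
    rw [← integral_add (S.integrable_y j z P) (S.integrable_y j z Q)]
    simp only [eval_add]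
    congr 1
    funext t
    ring
  map_smul' c Q := by
    simp only [Data.dual, RingHom.id_apply, smul_eq_mul]
    rw [← lineInt_const_mul]
    refine lineInt_congr fun t => ?_
    rw [eval_smul, smul_eq_mul]
    ring

theorem Data.laplace_apply (S : Data) (j : Fin S.d) (z : ℂ) (Q : ℂ[X]) :
    S.laplace j z Q = S.dual j (fun y => Q.eval y * S.W₂ y) z := rfl

theorem Data.mul_laplace (S : Data) (j : Fin S.d) (z : ℂ) (T : ℂ[X]) :
    z * S.laplace j z (S.B₂ * T) = -S.laplace j z (S.B₂ * derivative T - S.A₂ * T) := by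
  have := (S.admissible_y j).lineInt_exp_mul S.isWeight₂ S.B₂_ne_zero S.deg₂ z T
  simp only [Data.laplace_apply, Data.dual, ← mul_assoc]
  rw [this]
  ring

/-- Expanding the kernel in powers of `y` and integrating the coefficients over `s` gives `Q`. Only
finite sums are moved through integrals, so the different orders of integration in `aux` and
`concInt` cause no difficulty. -/
theorem Data.exists_aux_eq (S : Data) (k : Fin S.d) (x : ℂ) :
    ∃ Q : ℂ[X], Q.degree < S.d ∧
      (∀ (hx : S.OffContours x) (P : ℂ[X]),
        S.aux k (fun ξ => P.eval ξ * S.W₁ ξ) x = S.bimoment hx.isMultiplier P Q) ∧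
      ∀ j z, S.concInt j k z x = S.laplace j z Q := by
  obtain ⟨c, hc⟩ := exists_concomitant_eq_sum S.deg₂ x
  set I : ℕ → ℂ := fun a => lineInt (S.Γd k) fun s =>
    (c a).eval s * Complex.exp (-x * s) * S.Wd s with hI
  set ω : ℂ := 1 / (2 * Real.pi * Complex.I)
  have hint : ∀ a, Integrable fun t => (fun s => (c a).eval s * Complex.exp (-x * s) * S.Wd s)
      (S.Γd k t) * deriv (S.Γd k) t := fun a => S.integrable_d k (-x) (c a)
  refine ⟨∑ a ∈ Finset.range S.d, (ω * I a) • X ^ a, ?_, fun hx P => ?_, fun j z => ?_⟩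
  · refine mem_degreeLT.1 (Submodule.sum_mem _ fun a ha => Submodule.smul_mem _ _ ?_)
    rw [mem_degreeLT, degree_X_pow]
    exact_mod_cast Finset.mem_range.1 ha
  · have h1 : ∀ s, (S.dbl fun ξ y =>
        concomitant S.A₂ S.B₂ x y s * (Complex.exp (ξ * y - x * s) * S.W₂ y * S.Wd s) *
          (1 / (x - ξ)) * (P.eval ξ * S.W₁ ξ))
        = ∑ a ∈ Finset.range S.d, (c a).eval s * Complex.exp (-x * s) * S.Wd s *
          S.bimoment hx.isMultiplier P (X ^ a) := by
      intro s
      have h2 : S.bimoment hx.isMultiplier P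
          (∑ a ∈ Finset.range S.d, ((c a).eval s * Complex.exp (-x * s) * S.Wd s) • X ^ a) =
          ∑ a ∈ Finset.range S.d, (c a).eval s * Complex.exp (-x * s) * S.Wd s *
            S.bimoment hx.isMultiplier P (X ^ a) := by
        simp only [map_sum, map_smul, smul_eq_mul]
      rw [← h2, S.bimoment_apply]
      congr 1
      funext ξ y
      rw [hc, eval_finsetSum]
      simp only [eval_smul, smul_eq_mul, eval_pow, eval_X]
      rw [sub_eq_add_neg, Complex.exp_add, ← neg_mul]
      simp only [Finset.sum_mul, Finset.mul_sum]
      exact Finset.sum_congr rfl fun a _ => by ring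
    simp only [Data.aux, h1]
    rw [lineInt_sum_mul _ _ _ fun a _ => hint a, map_sum, Finset.mul_sum]
    refine Finset.sum_congr rfl fun a _ => ?_
    rw [map_smul, smul_eq_mul]
    exact (mul_assoc _ _ _).symm
  · have h1 : ∀ y, (lineInt (S.Γd k) fun s =>
        concomitant S.A₂ S.B₂ x y s * (Complex.exp (y * z - x * s) * S.Wd s * S.W₂ y))
        = ∑ a ∈ Finset.range S.d, I a * (y ^ a * Complex.exp (z * y) * S.W₂ y) := by
      intro y
      refine Eq.trans ?_ (lineInt_sum_mul (S.Γd k) (Finset.range S.d)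
        (f := fun a s => (c a).eval s * Complex.exp (-x * s) * S.Wd s)
        (fun a => y ^ a * Complex.exp (z * y) * S.W₂ y) fun a _ => hint a)
      refine lineInt_congr fun t => ?_
      rw [hc, sub_eq_add_neg, Complex.exp_add, ← neg_mul, mul_comm y z, Finset.sum_mul]
      exact Finset.sum_congr rfl fun a _ => by ring
    simp only [Data.concInt, h1, Data.laplace_apply, Data.dual]
    rw [← lineInt_const_mul]
    congr 1
    funext y
    rw [eval_finsetSum, Finset.mul_sum, Finset.sum_mul, Finset.mul_sum]
    refine Finset.sum_congr rfl fun a _ => ?_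
    rw [eval_smul, eval_pow, eval_X, smul_eq_mul]
    ring

theorem Data.φ_eq (S : Data) (s : ℕ → ℂ[X]) (n : ℕ) :
    S.φ s n = fun y => (s n).eval y * S.W₂ y := rfl

theorem Data.ψ_eq (S : Data) (p : ℕ → ℂ[X]) (n : ℕ) :
    S.ψ p n = fun x => (p n).eval x * S.W₁ x := rfl

theorem Data.φhat_eq (S : Data) (s : ℕ → ℂ[X]) (Lh : ℕ → ℕ → ℂ) (n : ℕ) :
    S.φhat s Lh n = fun y => (S.upperCombo Lh s n).eval y * S.W₂ y := by
  funext y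
  simp only [Data.φhat, Data.upperCombo, Data.φ, Pi.add_apply, Finset.sum_apply, Pi.smul_apply,
    eval_add, eval_finsetSum, eval_smul, smul_eq_mul, add_mul, Finset.sum_mul, mul_assoc]

theorem Data.dualZero_eq (S : Data) {z : ℂ} (hz : S.OffContours z) (Q : ℂ[X]) :
    S.dualZero (fun y => Q.eval y * S.W₂ y) z = (S.W₁ z)⁻¹ * S.bimoment hz.isMultiplier 1 Q := by
  rw [Data.dualZero, S.bimoment_apply]
  congr 2
  funext ξ y
  rw [eval_one]
  ring

/-! ### The identities for the wave vectors -/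

section Wave

variable {S : Data} {p s : ℕ → ℂ[X]} {Lh Ah : ℕ → ℕ → ℂ}

theorem Data.IsDiffRec.christoffelDarboux (h : S.IsDiffRec s Lh Ah)
    (hb : IsBiorthonormal S.bilin p s) {n : ℕ} (hn : 1 ≤ n) {z x : ℂ} (U V : ℂ[X] →ₗ[ℂ] ℂ)
    {e c : ℕ → ℂ}
    (hU : ∀ m T, S.upperCombo Lh s m = S.B₂ * T →
      z * U (S.B₂ * T) = -U (S.B₂ * derivative T - S.A₂ * T) + e m)
    (hV : ∀ r, x * V (p r) = V (X * p r) + c r) :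
    (z - x) * truncPair n (fun r => U (s r)) (fun r => V (p r)) =
        cdPair S.d n Lh Ah z (fun r => U (s r)) (fun r => V (hatPoly Lh p r))
        + (∑ r ∈ Finset.range n, e r * V (hatPoly Lh p r)
          - ∑ r ∈ Finset.range n, U (s r) * c r) ∧
      (z - x) * truncPair n (fun r => U (S.upperCombo Lh s r)) (fun r => V (hatPoly Lh p r)) =
        cdPair S.d n Lh Ah x (fun r => U (s r)) (fun r => V (hatPoly Lh p r))
        + (∑ r ∈ Finset.range n, e r * V (hatPoly Lh p r)
          - ∑ r ∈ Finset.range n, U (s r) * c r) := by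
  have hqd := S.q_lt_d
  refine CDI.christoffelDarboux hn (by omega) (fun i j hne => ?_) (fun i j hne => ?_)
    (fun m hm => ?_) (fun m hm => ?_) (fun r hr => ?_) (fun r hr => ?_)
  · have := h.band_L i j hne
    omega
  · have := h.band_A i j hne
    omega
  · rw [upperCombo_eq h.band_L s (N := n + S.d) (by omega)]
    simp only [map_add, map_sum, map_smul, smul_eq_mul]
  · obtain ⟨T, hT, -, hA⟩ := h.exists_factor hb.degree_right
      (show m + S.d < n + S.d by omega)
    rw [hT, hU m T hT, hA]
    simp only [map_neg, neg_neg, map_sum, map_smul, smul_eq_mul]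
  · conv_lhs => rw [h.eq_add_sum (p := p) (show r ≤ n + S.d by omega)]
    simp only [map_add, map_sum, map_smul, smul_eq_mul]
  · rw [hV, h.X_mul_eq_sum hb (show r + 2 ≤ n + S.d by omega)]
    simp only [map_sum, map_smul, smul_eq_mul]

theorem Data.IsDiffRec.christoffelDarboux_dualZero (h : S.IsDiffRec s Lh Ah)
    (hb : IsBiorthonormal S.bilin p s) {n : ℕ} (hn : 1 ≤ n) {z : ℂ} (hz : S.OffContours z)
    (x : ℂ) :
    (z - x) * truncPair n (fun r => S.dualZero (S.φ s r) z) (fun r => S.ψ p r x)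
        = cdPair S.d n Lh Ah z
            (fun r => S.dualZero (S.φ s r) z) (fun r => S.ψhat p Lh r x)
          + (S.W₁ z)⁻¹ * S.W₁ x ∧
      (z - x) * truncPair n
          (fun r => S.dualZero (S.φhat s Lh r) z) (fun r => S.ψhat p Lh r x)
        = cdPair S.d n Lh Ah x
            (fun r => S.dualZero (S.φ s r) z) (fun r => S.ψhat p Lh r x)
          + (S.W₁ z)⁻¹ * S.W₁ x := by
  set U : ℂ[X] →ₗ[ℂ] ℂ := (S.W₁ z)⁻¹ • S.bimoment hz.isMultiplier 1 with hUdef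
  set V : ℂ[X] →ₗ[ℂ] ℂ := S.W₁ x • leval x with hVdef
  have hU : ∀ Q, S.dualZero (fun y => Q.eval y * S.W₂ y) z = U Q := fun Q => by
    rw [S.dualZero_eq hz, hUdef, LinearMap.smul_apply, smul_eq_mul]
  have hV : ∀ P : ℂ[X], P.eval x * S.W₁ x = V P := fun P => by
    rw [hVdef, LinearMap.smul_apply, leval_apply, smul_eq_mul, mul_comm]
  have key := h.christoffelDarboux hb hn (z := z) (x := x) U V
    (e := fun m => (S.W₁ z)⁻¹ * S.bilin 1 (S.upperCombo Lh s m)) (c := 0)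
    (fun m T hT => by
      have h1 := hz.bimoment_X_mul 1 (S.B₂ * T)
      rw [S.bimoment_X_mul, ← S.bilin_apply] at h1
      simp only [hUdef, LinearMap.smul_apply, smul_eq_mul, hT]
      linear_combination (-(S.W₁ z)⁻¹) * h1)
    (fun r => by
      simp only [← hV, eval_mul, eval_X, Pi.zero_apply]
      ring)
  -- This sum is `V` applied to the expansion of the constant `1` in the `hatPoly` basis, which is
  -- complete as soon as `n ≥ 1`.
  have h1 : ∑ r ∈ Finset.range n, (S.W₁ z)⁻¹ * S.bilin 1 (S.upperCombo Lh s r) *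
      V (hatPoly Lh p r) = (S.W₁ z)⁻¹ * S.W₁ x := by
    have h2 := congrArg V (h.eq_sum_hatPoly hb (N := n) (P := 1) (by
      rw [degree_one]
      exact_mod_cast hn))
    rw [← hV 1, eval_one, one_mul] at h2
    simp only [map_sum, map_smul, smul_eq_mul] at h2
    rw [h2, Finset.mul_sum]
    simp only [mul_assoc]
  simp only [h1, Pi.zero_apply, mul_zero, Finset.sum_const_zero, sub_zero] at key
  simpa only [Data.φhat_eq, Data.φ_eq, Data.ψ_eq, Data.ψhat, hU, hV] using key

theorem Data.IsDiffRec.christoffelDarboux_dual (h : S.IsDiffRec s Lh Ah)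
    (hb : IsBiorthonormal S.bilin p s) {n : ℕ} (hn : S.d ≤ n) (j k : Fin S.d) (z : ℂ) {x : ℂ}
    (hx : S.OffContours x) :
    (z - x) * truncPair n (fun r => S.dual j (S.φ s r) z) (fun r => S.aux k (S.ψ p r) x)
        = cdPair S.d n Lh Ah z
            (fun r => S.dual j (S.φ s r) z) (fun r => S.aux k (S.ψhat p Lh r) x)
          - S.concInt j k z x ∧
      (z - x) * truncPair n
          (fun r => S.dual j (S.φhat s Lh r) z) (fun r => S.aux k (S.ψhat p Lh r) x)
        = cdPair S.d n Lh Ah x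
            (fun r => S.dual j (S.φ s r) z) (fun r => S.aux k (S.ψhat p Lh r) x)
          - S.concInt j k z x := by
  obtain ⟨Q, hQd, hQ, hconc⟩ := S.exists_aux_eq k x
  have hqd := S.q_lt_d
  have key := h.christoffelDarboux hb (by omega : 1 ≤ n) (z := z) (x := x) (S.laplace j z)
    ((S.bimoment hx.isMultiplier).flip Q) (e := 0) (c := fun r => S.bilin (p r) Q)
    (fun m T _ => by rw [S.mul_laplace, Pi.zero_apply, add_zero])
    (fun r => by
      rw [LinearMap.flip_apply, LinearMap.flip_apply, hx.bimoment_X_mul, S.bilin_apply]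
      ring)
  -- Since `deg Q < d ≤ n`, the polynomials `s 0, …, s (n - 1)` suffice to expand `Q`; applying the
  -- Laplace functional yields the concomitant integral.
  have h1 : ∑ r ∈ Finset.range n, S.laplace j z (s r) * S.bilin (p r) Q = S.concInt j k z x := by
    have h2 := congrArg (S.laplace j z)
      (hb.eq_sum_right (hQd.trans_le (by exact_mod_cast hn : (S.d : WithBot ℕ) ≤ n)))
    rw [hconc, h2, map_sum]
    simp only [map_smul, smul_eq_mul]
    exact Finset.sum_congr rfl fun r _ => mul_comm _ _
  simp only [h1, Pi.zero_apply, zero_mul, Finset.sum_const_zero, zero_sub,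
    ← sub_eq_add_neg] at key
  simpa only [Data.φhat_eq, Data.φ_eq, Data.ψ_eq, Data.ψhat, hQ hx, Data.laplace_apply,
    LinearMap.flip_apply] using key

end Wave

end CDI

end

theorem theorem4p2 (S : CDI.Data) (p s : ℕ → Polynomial ℂ)
    (hbop : CDI.IsNormalizedBOP S.ℒ p s)
    (hgen : ∀ n : ℕ, CDI.minor S.ℒhat n ≠ 0) :
    (∃! M : (ℕ → ℕ → ℂ) × (ℕ → ℕ → ℂ), S.IsDiffRec s M.1 M.2) ∧
    ∀ Lh Ah : ℕ → ℕ → ℂ, S.IsDiffRec s Lh Ah →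
      (∀ n : ℕ, 1 ≤ n → ∀ z ∈ S.D₁, S.OffContours z → ∀ x ∈ S.D₁,
        (z - x) * CDI.truncPair n (fun r => S.dualZero (S.φ s r) z) (fun r => S.ψ p r x)
          = CDI.cdPair S.d n Lh Ah z
              (fun r => S.dualZero (S.φ s r) z) (fun r => S.ψhat p Lh r x)
            + (S.W₁ z)⁻¹ * S.W₁ x ∧
        (z - x) * CDI.truncPair n
            (fun r => S.dualZero (S.φhat s Lh r) z) (fun r => S.ψhat p Lh r x)
          = CDI.cdPair S.d n Lh Ah x
              (fun r => S.dualZero (S.φ s r) z) (fun r => S.ψhat p Lh r x)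
            + (S.W₁ z)⁻¹ * S.W₁ x) ∧
      (∀ n : ℕ, S.d ≤ n → ∀ j k : Fin S.d, ∀ z x : ℂ, S.OffContours x →
        (z - x) * CDI.truncPair n
            (fun r => S.dual j (S.φ s r) z) (fun r => S.aux k (S.ψ p r) x)
          = CDI.cdPair S.d n Lh Ah z
              (fun r => S.dual j (S.φ s r) z) (fun r => S.aux k (S.ψhat p Lh r) x)
            - S.concInt j k z x ∧
        (z - x) * CDI.truncPair n
            (fun r => S.dual j (S.φhat s Lh r) z) (fun r => S.aux k (S.ψhat p Lh r) x)
          = CDI.cdPair S.d n Lh Ah x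
              (fun r => S.dual j (S.φ s r) z) (fun r => S.aux k (S.ψhat p Lh r) x)
            - S.concInt j k z x) := by
  have hb : CDI.IsBiorthonormal S.bilin p s := by
    refine CDI.IsNormalizedBOP.isBiorthonormal ?_
    simpa only [S.bilin_apply] using hbop
  refine ⟨?_, fun Lh Ah h => ⟨fun n hn z _ hz x _ => h.christoffelDarboux_dualZero hb hn hz x,
    fun n hn j k z x hx => h.christoffelDarboux_dual hb hn j k z hx⟩⟩
  obtain ⟨Lh, Ah, h⟩ := CDI.Data.exists_isDiffRec hb hgen
  refine ⟨(Lh, Ah), h, fun M hM => ?_⟩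
  obtain ⟨h1, h2⟩ := CDI.Data.IsDiffRec.unique hM h hb hgen
  exact Prod.ext h1 h2
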